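/- **Setting.** *Programs* are closed expressions of an untyped call-by-value $\lambda$-calculus with pairs, conditionals, integers, references, equality and arithmetic operators, named functions and a command $\mathsf{emit}\ v$ (the evaluation of an abstraction binds it to a fresh function name in a function environment, and functional values are names). A *machine state* is a pair of a finite heap and a finite function environment. The relation $e,s \xrightarrow{t}{}^{*} e',s'$ is the reflexive-transitive closure of the reduction relation, where the *trace* $t$ is the finite sequence of the closed values emitted by the steps, and $e',s' \not\rightarrow$ says that no step is possible. $e_1; e_2$ abbreviates $(\lambda\_.\,e_2)\,e_1$. Specifications are written in an affine higher-order separation logic over a simply typed term language whose types include $\mathsf{Bool}$, $\mathsf{Prop}$ (resource assertions), $\mathsf{Spec}$ (specifications), $\mathsf{Val}$, $\mathsf{Exp}$ and $\mathsf{seq}\,\mathsf{Val}$ (finite sequences of values). Besides the usual assertions of separation logic there are $\mathsf{trace}(t)$ (exclusive ownership of the current trace, which is $t$), $\mathsf{hist}(t)$ ($t$ is a prefix of the current trace) and $\mathsf{inv}(I)$ (the trace invariant is $I$). Hoare triples $\{P\}\,e\,\{Q\}$ are specifications, and $\mathsf{emit}\ v$ is governed by the rule: if $t\cdot v\in I$,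 then $\{\mathsf{trace}(t) * \mathsf{inv}(I)\}\ \mathsf{emit}\ v\ \{r.\ \mathsf{trace}(t\cdot v) * r = ()\}$. We write $\vdash S$ if the specification $S$ is derivable in the proof system of this logic from no hypotheses and without free variables. **Theorem.** Let $\Phi$ be a closed term of type $\mathsf{Prop}\times\mathsf{Exp}\to\mathsf{Spec}$ (an abstract library specification), $P_0$ a closed term of type $\mathsf{Prop}$, $I_{\mathit{init}}$ (an initialiser) and $I_{\mathit{ops}}$ (a library implementation) closed terms of type $\mathsf{Exp}$, and $e$ (a client) a term of type $\mathsf{Exp}$ whose only free variable is $\mathit{ops} : \mathsf{Exp}$. Let $\mathcal L$ be a set of traces that contains the empty trace $\varepsilon$ and is given by a closed term of type $\mathsf{seq}\,\mathsf{Val}\to\mathsf{Bool}$. Let $s,s'$ be machine states, $t$ a trace and $e'$ a closed expression. If 1. $\vdash \forall \mathit{ops}:\mathsf{Exp}.\ \forall P:\mathsf{Prop}.\ \Phi(P,\mathit{ops}) \Rightarrow \{P\}\ e\ \{\top\}$, 2. $\vdash \{\top\}\ I_{\mathit{init}}\ \{P_0\}$, 3. $\vdash \Phi\bigl(P_0 *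 \mathsf{trace}(\varepsilon) * \mathsf{inv}(\mathcal L),\ I_{\mathit{ops}}\bigr)$, 4. $(I_{\mathit{init}};\, e[I_{\mathit{ops}}/\mathit{ops}]),\, s \xrightarrow{t}{}^{*} e', s'$ and $e',s'\not\rightarrow$, then $t\in\mathcal L$. -/

import Mathlib

namespace TraceSL

/-! ## The programming language

Variables bound by program abstractions are well-scoped de Bruijn indices. Every functional value
is a name; abstractions are expressions that reduce to a fresh name. -/

/-- Location identifiers: a countably infinite set. -/
abbrev Loc := ℕ

/-- Function identifiers: a countably infinite set. -/
abbrev FunName := ℕ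

/-- Arithmetic operators. -/
inductive Arith : Type
  | add | sub | mul | lt

/-- The integer computed by an arithmetic operator (truth values are `1` and `0`). -/
def Arith.eval : Arith → ℤ → ℤ → ℤ
  | .add, a, b => a + b
  | .sub, a, b => a - b
  | .mul, a, b => a * b
  | .lt, a, b => if a < b then 1 else 0

/-- Binary operators: equality test, assignment, arithmetic. -/
inductive Op : Type
  | eq
  | assign
  | arith (o : Arith)

/-- Values with `n` free program variables. -/
inductive Value (n : ℕ) : Type
  | unit : Value n
  | int (z : ℤ) : Value n
  | var (i : Fin n) : Value n
  | loc (l : Loc) : Value n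
  | fn (f : FunName) : Value n
  | pair (u v : Value n) : Value n

/-- Expressions with `n` free program variables. -/
inductive Expr : ℕ → Type
  | unit {n : ℕ} : Expr n
  | int {n : ℕ} (z : ℤ) : Expr n
  | var {n : ℕ} (i : Fin n) : Expr n
  | loc {n : ℕ} (l : Loc) : Expr n
  | fn {n : ℕ} (f : FunName) : Expr n
  | lam {n : ℕ} (e : Expr (n + 1)) : Expr n
  | app {n : ℕ} (e e' : Expr n) : Expr n
  | ite {n : ℕ} (e e₁ e₂ : Expr n) : Expr n
  | pair {n : ℕ} (e e' : Expr n) : Expr n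
  | fst {n : ℕ} (e : Expr n) : Expr n
  | snd {n : ℕ} (e : Expr n) : Expr n
  | ref {n : ℕ} (e : Expr n) : Expr n
  | deref {n : ℕ} (e : Expr n) : Expr n
  | binop {n : ℕ} (o : Op) (e e' : Expr n) : Expr n
  | emit {n : ℕ} (v : Value n) : Expr n

/-- Closed values. -/
abbrev Val := Value 0

/-- Closed expressions. -/
abbrev Exp := Expr 0

/-- Values form a subset of the expressions; in particular a pair of values is a value. -/
def Value.toExpr {n : ℕ} : Value n → Expr n
  | .unit => .unit
  | .int z => .int z
  | .var i => .var i
  | .loc l => .loc l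
  | .fn f => .fn f
  | .pair u v => .pair u.toExpr v.toExpr

/-- A closed value, seen as a value in a larger scope. -/
def Value.wk {n : ℕ} : Value 0 → Value n
  | .unit => .unit
  | .int z => .int z
  | .var i => i.elim0
  | .loc l => .loc l
  | .fn f => .fn f
  | .pair u v => .pair u.wk v.wk

/-- Parallel substitutions for program variables: each of `n` variables is sent to one of `m`
variables or to a closed object of type `α`. -/
abbrev PSub (α : Type) (n m : ℕ) := Fin n → Fin m ⊕ α

/-- Extension of a substitution under a binder. -/
def PSub.up {α : Type} {n m : ℕ} (σ : PSub α n m) : PSub α (n + 1) (m + 1) :=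
  Fin.cases (.inl 0) (fun i => (σ i).map Fin.succ id)

/-- The substitution of a closed object for the only variable. -/
def PSub.one {α : Type} (a : α) : PSub α 1 0 := fun _ => .inr a

/-- The substitution with empty domain (weakening of closed objects). -/
def PSub.empty {α : Type} {m : ℕ} : PSub α 0 m := fun i => i.elim0

def Value.subst {n m : ℕ} (σ : PSub Val n m) : Value n → Value m
  | .unit => .unit
  | .int z => .int z
  | .var i => (σ i).elim .var Value.wk
  | .loc l => .loc l
  | .fn f => .fn f
  | .pair u v => .pair (u.subst σ) (v.subst σ)

def Expr.subst : {n : ℕ} → Expr n → {m : ℕ} → PSub Val n m → Expr m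
  | _, .unit, _, _ => .unit
  | _, .int z, _, _ => .int z
  | _, .var i, _, σ => (σ i).elim .var (fun v => v.wk.toExpr)
  | _, .loc l, _, _ => .loc l
  | _, .fn f, _, _ => .fn f
  | _, .lam e, _, σ => .lam (e.subst σ.up)
  | _, .app e e', _, σ => .app (e.subst σ) (e'.subst σ)
  | _, .ite e e₁ e₂, _, σ => .ite (e.subst σ) (e₁.subst σ) (e₂.subst σ)
  | _, .pair e e', _, σ => .pair (e.subst σ) (e'.subst σ)
  | _, .fst e, _, σ => .fst (e.subst σ)
  | _, .snd e, _, σ => .snd (e.subst σ)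
  | _, .ref e, _, σ => .ref (e.subst σ)
  | _, .deref e, _, σ => .deref (e.subst σ)
  | _, .binop o e e', _, σ => .binop o (e.subst σ) (e'.subst σ)
  | _, .emit v, _, σ => .emit (v.subst σ)

/-- `e{v/x}` for the body `e` of an abstraction. -/
def Expr.inst (e : Expr 1) (v : Val) : Exp := e.subst (PSub.one v)

/-- Heaps: finite maps from locations to values. -/
abbrev Heap := Finmap (fun _ : Loc => Val)

/-- Function environments: finite maps from function names to (bodies of) abstractions. -/
abbrev FEnv := Finmap (fun _ : FunName => Expr 1)

/-- Machine states. -/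
structure State : Type where
  heap : Heap
  env : FEnv

/-- Traces: finite sequences of closed values. -/
abbrev Trace := List Val

/-- Evaluation contexts. -/
inductive ECtx : Type
  | hole
  | appL (K : ECtx) (e : Exp)
  | appR (v : Val) (K : ECtx)
  | opL (o : Op) (K : ECtx) (e : Exp)
  | opR (o : Op) (v : Val) (K : ECtx)
  | ite (K : ECtx) (e₁ e₂ : Exp)
  | pairL (K : ECtx) (e : Exp)
  | pairR (v : Val) (K : ECtx)
  | fst (K : ECtx)
  | snd (K : ECtx)
  | ref (K : ECtx)
  | deref (K : ECtx)

/-- `K[e]`. -/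
def ECtx.fill : ECtx → Exp → Exp
  | .hole, a => a
  | .appL K e, a => .app (K.fill a) e
  | .appR v K, a => .app v.toExpr (K.fill a)
  | .opL o K e, a => .binop o (K.fill a) e
  | .opR o v K, a => .binop o v.toExpr (K.fill a)
  | .ite K e₁ e₂, a => .ite (K.fill a) e₁ e₂
  | .pairL K e, a => .pair (K.fill a) e
  | .pairR v K, a => .pair v.toExpr (K.fill a)
  | .fst K, a => .fst (K.fill a)
  | .snd K, a => .snd (K.fill a)
  | .ref K, a => .ref (K.fill a)
  | .deref K, a => .deref (K.fill a)

/-- Reduction of redexes. The label is `some v` if the event `v` is emitted, and `none` otherwise. -/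
inductive Head : Exp → State → Option Val → Exp → State → Prop
  | lam (b : Expr 1) (h : Heap) (γ : FEnv) (f : FunName) (hf : f ∉ γ) :
      Head (.lam b) ⟨h, γ⟩ none (.fn f) ⟨h, γ.insert f b⟩
  | call (f : FunName) (v : Val) (b : Expr 1) (h : Heap) (γ : FEnv) (hf : γ.lookup f = some b) :
      Head (.app (.fn f) v.toExpr) ⟨h, γ⟩ none (b.inst v) ⟨h, γ⟩
  | fst (u v : Val) (s : State) : Head (.fst (.pair u.toExpr v.toExpr)) s none u.toExpr s
  | snd (u v : Val) (s : State) : Head (.snd (.pair u.toExpr v.toExpr)) s none v.toExpr s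
  | itePos (z : ℤ) (e₁ e₂ : Exp) (s : State) (hz : 0 < z) : Head (.ite (.int z) e₁ e₂) s none e₁ s
  | iteZero (e₁ e₂ : Exp) (s : State) : Head (.ite (.int 0) e₁ e₂) s none e₂ s
  | ref (v : Val) (l : Loc) (h : Heap) (γ : FEnv) (hl : l ∉ h) :
      Head (.ref v.toExpr) ⟨h, γ⟩ none (.loc l) ⟨h.insert l v, γ⟩
  | deref (l : Loc) (v : Val) (h : Heap) (γ : FEnv) (hl : h.lookup l = some v) :
      Head (.deref (.loc l)) ⟨h, γ⟩ none v.toExpr ⟨h, γ⟩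
  | assign (l : Loc) (v : Val) (h : Heap) (γ : FEnv) (hl : l ∈ h) :
      Head (.binop .assign (.loc l) v.toExpr) ⟨h, γ⟩ none .unit ⟨h.insert l v, γ⟩
  | eqTrue (v : Val) (s : State) : Head (.binop .eq v.toExpr v.toExpr) s none (.int 1) s
  | eqFalse (u v : Val) (s : State) (huv : u ≠ v) :
      Head (.binop .eq u.toExpr v.toExpr) s none (.int 0) s
  | arith (o : Arith) (a b : ℤ) (s : State) :
      Head (.binop (.arith o) (.int a) (.int b)) s none (.int (o.eval a b)) s
  | emit (v : Val) (s : State) : Head (.emit v) s (some v) .unit s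

/-- One labelled reduction step. -/
inductive Step : Exp → State → Option Val → Exp → State → Prop
  | ctx (K : ECtx) {e e' : Exp} {s s' : State} {a : Option Val} (h : Head e s a e' s') :
      Step (K.fill e) s a (K.fill e') s'

/-- The reflexive transitive closure of reduction, labelled by the trace of the emitted events. -/
inductive Steps : Exp → State → Trace → Exp → State → Prop
  | refl (e : Exp) (s : State) : Steps e s [] e s
  | step {e e' e'' : Exp} {s s' s'' : State} {a : Option Val} {t : Trace}
      (h : Step e s a e' s') (hs : Steps e' s' t e'' s'') : Steps e s (a.toList ++ t) e'' s''

/-- The configuration `e, s` does not reduce. -/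
def Stuck (e : Exp) (s : State) : Prop := ∀ a e' s', ¬ Step e s a e' s'

/-! ## Resources, worlds and the semantic domains -/

/-- Trace resources: `hist t` stands for `t` being a prefix of the current trace, `trace t` for
the exclusive ownership of the current trace `t`. -/
inductive TRes : Type
  | hist (t : Trace)
  | trace (t : Trace)

/-- `TJoin a b c`: the composition of `a` and `b` is defined and equal to `c`. -/
inductive TJoin : TRes → TRes → TRes → Prop
  | histL {t₁ t₂ : Trace} (h : t₂ <+: t₁) : TJoin (.hist t₁) (.hist t₂) (.hist t₁)
  | histR {t₁ t₂ : Trace} (h : t₁ <+: t₂) : TJoin (.hist t₁) (.hist t₂) (.hist t₂)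
  | traceL {t₁ t₂ : Trace} (h : t₂ <+: t₁) : TJoin (.trace t₁) (.hist t₂) (.trace t₁)
  | traceR {t₁ t₂ : Trace} (h : t₁ <+: t₂) : TJoin (.hist t₁) (.trace t₂) (.trace t₂)

/-- The resource monoid: heaps times trace resources. -/
abbrev Res := Heap × TRes

/-- `Join a b c`: the composition of `a` and `b` is defined and equal to `c`; on heaps it is
disjoint union. -/
def Join (a b c : Res) : Prop :=
  (a.1.Disjoint b.1 ∧ c.1 = a.1 ∪ b.1) ∧ TJoin a.2 b.2 c.2

/-- The unit of the resource monoid. -/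
def Res.one : Res := (∅, .hist [])

/-- The order on resources. -/
def Res.Le (a b : Res) : Prop := ∃ c, Join a c b

theorem Join.one (a : Res) : Join a Res.one a := by
  obtain ⟨h, t⟩ := a
  refine ⟨⟨?_, ?_⟩, ?_⟩
  · intro x _ hx
    exact Finmap.notMem_empty hx
  · simp [Res.one]
  · cases t
    · exact .histL (List.nil_prefix)
    · exact .traceL (List.nil_prefix)

theorem Res.Le.refl (a : Res) : a.Le a := ⟨_, Join.one a⟩

theorem TJoin.assoc {a b ab c abc : TRes} (h₁ : TJoin a b ab) (h₂ : TJoin ab c abc) :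
    ∃ bc, TJoin b c bc ∧ TJoin a bc abc := by
  cases h₁ <;> cases h₂ <;> rename_i p _ q
  · rcases List.prefix_or_prefix_of_prefix p q with r | r
    · exact ⟨_, .histR r, .histL q⟩
    · exact ⟨_, .histL r, .histL p⟩
  · exact ⟨_, .histR (p.trans q), .histR q⟩
  · exact ⟨_, .traceR (p.trans q), .traceR q⟩
  · exact ⟨_, .histL q, .histR p⟩
  · exact ⟨_, .histR q, .histR (p.trans q)⟩
  · exact ⟨_, .traceR q, .traceR (p.trans q)⟩
  · rcases List.prefix_or_prefix_of_prefix p q with r | r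
    · exact ⟨_, .histR r, .traceL q⟩
    · exact ⟨_, .histL r, .traceL p⟩
  · exact ⟨_, .traceL q, .traceR p⟩

theorem Join.assoc {a b ab c abc : Res} (h₁ : Join a b ab) (h₂ : Join ab c abc) :
    ∃ bc, Join b c bc ∧ Join a bc abc := by
  obtain ⟨⟨d₁, e₁⟩, t₁⟩ := h₁
  obtain ⟨⟨d₂, e₂⟩, t₂⟩ := h₂
  obtain ⟨bc, t₃, t₄⟩ := t₁.assoc t₂
  rw [e₁, Finmap.disjoint_union_left] at d₂
  refine ⟨(b.1 ∪ c.1, bc), ⟨⟨d₂.2, rfl⟩, t₃⟩, ⟨⟨?_, ?_⟩, t₄⟩⟩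
  · exact (Finmap.disjoint_union_right _ _ _).2 ⟨d₁, d₂.1⟩
  · rw [e₂, e₁, Finmap.union_assoc]

theorem Res.Le.trans {a b c : Res} (h₁ : a.Le b) (h₂ : b.Le c) : a.Le c := by
  obtain ⟨x, h₁⟩ := h₁
  obtain ⟨y, h₂⟩ := h₂
  obtain ⟨z, -, h⟩ := h₁.assoc h₂
  exact ⟨z, h⟩

/-- Worlds: a function environment and a trace invariant. -/
structure World : Type where
  env : FEnv
  inv : Set Trace

/-- The environment may grow with time, the invariant does not change. -/
instance : Preorder World where
  le w w' := (∀ f b, w.env.lookup f = some b → w'.env.lookup f = some b) ∧ w.inv = w'.inv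
  le_refl _ := ⟨fun _ _ h => h, rfl⟩
  le_trans _ _ _ h h' := ⟨fun f b hf => h'.1 f b (h.1 f b hf), h.2.trans h'.2⟩

/-- Semantic assertions: monotone functions from worlds to upwards closed sets of resources. -/
@[ext]
structure SemProp : Type where
  sat : World → Set Res
  mono : ∀ {w w' : World}, w ≤ w' → sat w ⊆ sat w'
  upper : ∀ {w : World} {m m' : Res}, m ∈ sat w → m.Le m' → m' ∈ sat w

/-- Semantic specifications: monotone functions from worlds to truth values. -/
@[ext]
structure SemSpec : Type where
  holds : World → Prop
  mono : ∀ {w w' : World}, w ≤ w' → holds w → holds w'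

/-- `t, s ⊨_w m`: the trace `t` and the machine state `s` realize the resource `m` in `w`. -/
def Realizes (t : Trace) (s : State) (w : World) (m : Res) : Prop :=
  (match m.2 with
    | .trace t' => t = t'
    | .hist t' => t' <+: t) ∧
  s.heap = m.1 ∧ s.env = w.env ∧ t ∈ w.inv

/-- The operator whose greatest fixed point is the weakest precondition. -/
def wpStep (Q : Val → SemProp) : (Exp → World → Set Res) →o (Exp → World → Set Res) where
  toFun X e w := {m | ∀ (r mr : Res) (t : Trace) (s : State), Join m r mr → Realizes t s w mr →
    (Stuck e s → ∃ v : Val, e = v.toExpr ∧ m ∈ (Q v).sat w) ∧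
    ∀ (a : Option Val) (e' : Exp) (s' : State), Step e s a e' s' →
      ∃ (w' : World) (m' mr' : Res), w ≤ w' ∧ Join m' r mr' ∧
        Realizes (t ++ a.toList) s' w' mr' ∧ m' ∈ X e' w'}
  monotone' := by
    intro X Y hXY e w m hm r mr t s hj hr
    refine ⟨(hm r mr t s hj hr).1, fun a e' s' hs => ?_⟩
    obtain ⟨w', m', mr', h₁, h₂, h₃, h₄⟩ := (hm r mr t s hj hr).2 a e' s' hs
    exact ⟨w', m', mr', h₁, h₂, h₃, hXY e' w' h₄⟩

/-- The weakest precondition. -/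
def wp (Q : Val → SemProp) : Exp → World → Set Res := OrderHom.gfp (wpStep Q)

namespace SemProp

def star (P Q : SemProp) : SemProp where
  sat w := {m | ∃ m₁ m₂, m₁ ∈ P.sat w ∧ m₂ ∈ Q.sat w ∧ Join m₁ m₂ m}
  mono := by
    rintro w w' h m ⟨m₁, m₂, h₁, h₂, hj⟩
    exact ⟨m₁, m₂, P.mono h h₁, Q.mono h h₂, hj⟩
  upper := by
    rintro w m m' ⟨m₁, m₂, h₁, h₂, hj⟩ ⟨c, hc⟩
    obtain ⟨bc, hbc, h⟩ := hj.assoc hc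
    exact ⟨m₁, bc, h₁, Q.upper h₂ ⟨c, hbc⟩, h⟩

def wand (P Q : SemProp) : SemProp where
  sat w := {m | ∀ w', w ≤ w' → ∀ m', m.Le m' → ∀ m'' mm, Join m' m'' mm →
    m'' ∈ P.sat w' → mm ∈ Q.sat w'}
  mono h _ hm w' hw' := hm w' (h.trans hw')
  upper hm h w' hw' m' hm' := hm w' hw' m' (h.trans hm')

/-- Assertions that do not depend on the resource. -/
def pure (S : World → Prop) (hS : ∀ {w w' : World}, w ≤ w' → S w → S w') : SemProp where
  sat w := {_m | S w}
  mono h _ hm := hS h hm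
  upper hm _ := hm

def pointsTo (l : Loc) (v : Val) : SemProp where
  sat _ := {m | m.1.lookup l = some v}
  mono _ _ h := h
  upper := by
    rintro w m m' h ⟨c, ⟨hd, he⟩, -⟩
    have h : Finmap.lookup l m.1 = some v := h
    change Finmap.lookup l m'.1 = some v
    have hl : l ∈ m.1 := Finmap.mem_iff.2 ⟨v, h⟩
    rw [he, Finmap.lookup_union_left hl, h]

/-- `trace(t)`, for `τ = trace t`, and `hist(t)`, for `τ = hist t`. -/
def tracing (τ : TRes) : SemProp where
  sat _ := {m | ∃ c, TJoin τ c m.2}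
  mono _ _ h := h
  upper := by
    rintro w m m' ⟨c, hc⟩ ⟨d, -, hd⟩
    obtain ⟨x, -, hx⟩ := hc.assoc hd
    exact ⟨x, hx⟩

end SemProp

namespace SemSpec

def valid (P : SemProp) : SemSpec where
  holds w := P.sat w = Set.univ
  mono h hw := Set.eq_univ_of_univ_subset (hw ▸ P.mono h)

def hoare (P : SemProp) (e : Exp) (Q : Val → SemProp) : SemSpec where
  holds w := ∀ w', w ≤ w' → P.sat w' ⊆ wp Q e w'
  mono h hw w' hw' := hw w' (h.trans hw')

end SemSpec

/-! ## Types, terms and their interpretation -/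

/-- The types of truth values: Booleans, resource assertions and specifications. -/
inductive Kind : Type
  | bool | prop | spec

/-- Types. -/
inductive Ty : Type
  | unit
  | nat
  | truth (k : Kind)
  | arrow (σ τ : Ty)
  | prod (σ τ : Ty)
  | seq (τ : Ty)
  | val
  | exp
  | loc

abbrev Ty.bool : Ty := .truth .bool
abbrev Ty.prop : Ty := .truth .prop
abbrev Ty.spec : Ty := .truth .spec

@[reducible]
def Kind.denote : Kind → Type
  | .bool => Bool
  | .prop => SemProp
  | .spec => SemSpec

@[reducible]
def Ty.denote : Ty → Type
  | .unit => Unit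
  | .nat => ℕ
  | .truth k => k.denote
  | .arrow σ τ => σ.denote → τ.denote
  | .prod σ τ => σ.denote × τ.denote
  | .seq τ => List τ.denote
  | .val => Val
  | .exp => Exp
  | .loc => Loc

/-! The connectives at the three types of truth values. -/

namespace Kind

def bot : (k : Kind) → k.denote
  | .bool => false
  | .prop => ⟨fun _ => ∅, fun _ => subset_rfl, fun h _ => h⟩
  | .spec => ⟨fun _ => False, fun _ h => h⟩

def top : (k : Kind) → k.denote
  | .bool => true
  | .prop => ⟨fun _ => Set.univ, fun _ => subset_rfl, fun h _ => h⟩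
  | .spec => ⟨fun _ => True, fun _ h => h⟩

def and : (k : Kind) → k.denote → k.denote → k.denote
  | .bool, a, b => Bool.and a b
  | .prop, P, Q => ⟨fun w => SemProp.sat P w ∩ SemProp.sat Q w,
      fun h => Set.inter_subset_inter (P.mono h) (Q.mono h),
      fun hm h => ⟨P.upper hm.1 h, Q.upper hm.2 h⟩⟩
  | .spec, S, T => ⟨fun w => SemSpec.holds S w ∧ SemSpec.holds T w,
      fun h hw => ⟨S.mono h hw.1, T.mono h hw.2⟩⟩

def or : (k : Kind) → k.denote → k.denote → k.denote
  | .bool, a, b => Bool.or a b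
  | .prop, P, Q => ⟨fun w => SemProp.sat P w ∪ SemProp.sat Q w,
      fun h => Set.union_subset_union (P.mono h) (Q.mono h),
      fun hm h => hm.imp (fun x => P.upper x h) (fun x => Q.upper x h)⟩
  | .spec, S, T => ⟨fun w => SemSpec.holds S w ∨ SemSpec.holds T w,
      fun h hw => hw.imp (S.mono h) (T.mono h)⟩

def imp : (k : Kind) → k.denote → k.denote → k.denote
  | .bool, a, b => Bool.or (Bool.not a) b
  | .prop, P, Q => ⟨fun w => {m | ∀ m', m.Le m' → ∀ w', w ≤ w' →
        m' ∈ SemProp.sat P w' → m' ∈ SemProp.sat Q w'},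
      fun h _ hm m' hm' w' hw' => hm m' hm' w' (h.trans hw'),
      fun hm h m' hm' => hm m' (h.trans hm')⟩
  | .spec, S, T => ⟨fun w => ∀ w', w ≤ w' → SemSpec.holds S w' → SemSpec.holds T w',
      fun h hw w' hw' => hw w' (h.trans hw')⟩

open Classical in
noncomputable def all : (k : Kind) → {α : Type} → (α → k.denote) → k.denote
  | .bool, _, f => decide (∀ x, f x = true)
  | .prop, _, f => ⟨fun w => {m | ∀ x, m ∈ SemProp.sat (f x) w},
      fun h _ hm x => (f x).mono h (hm x), fun hm h x => (f x).upper (hm x) h⟩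
  | .spec, _, f => ⟨fun w => ∀ x, SemSpec.holds (f x) w, fun h hw x => (f x).mono h (hw x)⟩

open Classical in
noncomputable def ex : (k : Kind) → {α : Type} → (α → k.denote) → k.denote
  | .bool, _, f => decide (∃ x, f x = true)
  | .prop, _, f => ⟨fun w => {m | ∃ x, m ∈ SemProp.sat (f x) w},
      fun h _ hm => hm.imp fun x hx => (f x).mono h hx,
      fun hm h => hm.imp fun x hx => (f x).upper hx h⟩
  | .spec, _, f => ⟨fun w => ∃ x, SemSpec.holds (f x) w,
      fun h hw => hw.imp fun x hx => (f x).mono h hx⟩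

open Classical in
noncomputable def eq : (k : Kind) → {α : Type} → α → α → k.denote
  | .bool, _, x, y => decide (x = y)
  | .prop, _, x, y => SemProp.pure (fun _ => x = y) (fun _ h => h)
  | .spec, _, x, y => ⟨fun _ => x = y, fun _ h => h⟩

end Kind

/-- Term contexts. -/
abbrev TCtx := List Ty

/-- Variables of type `τ` in a context. -/
inductive Var : TCtx → Ty → Type
  | zero {Γ : TCtx} {τ : Ty} : Var (τ :: Γ) τ
  | succ {Γ : TCtx} {σ τ : Ty} (x : Var Γ τ) : Var (σ :: Γ) τ

/-- The syntactic classes of the term language: terms of a type, and program values and program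
expressions with `n` program variables bound by enclosing program abstractions. -/
inductive Cls : Type
  | ty (τ : Ty)
  | pval (n : ℕ)
  | pexp (n : ℕ)

/-- Well-typed terms. Program values and expressions may mention logical variables, and more
generally terms of type `val` and `exp`. -/
inductive Tm : TCtx → Cls → Type
  -- simply typed lambda calculus with pairs, Booleans, numbers and finite sequences
  | var {Γ : TCtx} {τ : Ty} (x : Var Γ τ) : Tm Γ (.ty τ)
  | lam {Γ : TCtx} {σ τ : Ty} (M : Tm (σ :: Γ) (.ty τ)) : Tm Γ (.ty (.arrow σ τ))
  | app {Γ : TCtx} {σ τ : Ty} (M : Tm Γ (.ty (.arrow σ τ))) (N : Tm Γ (.ty σ)) : Tm Γ (.ty τ)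
  | unit {Γ : TCtx} : Tm Γ (.ty .unit)
  | pair {Γ : TCtx} {σ τ : Ty} (M : Tm Γ (.ty σ)) (N : Tm Γ (.ty τ)) : Tm Γ (.ty (.prod σ τ))
  | fst {Γ : TCtx} {σ τ : Ty} (M : Tm Γ (.ty (.prod σ τ))) : Tm Γ (.ty σ)
  | snd {Γ : TCtx} {σ τ : Ty} (M : Tm Γ (.ty (.prod σ τ))) : Tm Γ (.ty τ)
  | ite {Γ : TCtx} {τ : Ty} (M : Tm Γ (.ty (.truth .bool))) (N₁ N₂ : Tm Γ (.ty τ)) : Tm Γ (.ty τ)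
  | zero {Γ : TCtx} : Tm Γ (.ty .nat)
  | succ {Γ : TCtx} (M : Tm Γ (.ty .nat)) : Tm Γ (.ty .nat)
  | natrec {Γ : TCtx} {σ : Ty} (M : Tm Γ (.ty .nat)) (N₁ : Tm Γ (.ty σ))
      (N₂ : Tm Γ (.ty (.arrow (.prod σ .nat) σ))) : Tm Γ (.ty σ)
  | nil {Γ : TCtx} {τ : Ty} : Tm Γ (.ty (.seq τ))
  | cons {Γ : TCtx} {τ : Ty} (M : Tm Γ (.ty τ)) (N : Tm Γ (.ty (.seq τ))) : Tm Γ (.ty (.seq τ))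
  | fold {Γ : TCtx} {σ τ : Ty} (M : Tm Γ (.ty (.seq τ))) (N₁ : Tm Γ (.ty σ))
      (N₂ : Tm Γ (.ty (.arrow (.prod σ τ) σ))) : Tm Γ (.ty σ)
  | loc {Γ : TCtx} (l : Loc) : Tm Γ (.ty .loc)
  -- higher-order logic, at each of the three types of truth values
  | bot {Γ : TCtx} (k : Kind) : Tm Γ (.ty (.truth k))
  | top {Γ : TCtx} (k : Kind) : Tm Γ (.ty (.truth k))
  | and {Γ : TCtx} {k : Kind} (P Q : Tm Γ (.ty (.truth k))) : Tm Γ (.ty (.truth k))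
  | or {Γ : TCtx} {k : Kind} (P Q : Tm Γ (.ty (.truth k))) : Tm Γ (.ty (.truth k))
  | imp {Γ : TCtx} {k : Kind} (P Q : Tm Γ (.ty (.truth k))) : Tm Γ (.ty (.truth k))
  | all {Γ : TCtx} {k : Kind} (τ : Ty) (P : Tm (τ :: Γ) (.ty (.truth k))) : Tm Γ (.ty (.truth k))
  | ex {Γ : TCtx} {k : Kind} (τ : Ty) (P : Tm (τ :: Γ) (.ty (.truth k))) : Tm Γ (.ty (.truth k))
  | eq {Γ : TCtx} (k : Kind) {τ : Ty} (M N : Tm Γ (.ty τ)) : Tm Γ (.ty (.truth k))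
  -- separation logic
  | emp {Γ : TCtx} : Tm Γ (.ty (.truth .prop))
  | star {Γ : TCtx} (P Q : Tm Γ (.ty (.truth .prop))) : Tm Γ (.ty (.truth .prop))
  | wand {Γ : TCtx} (P Q : Tm Γ (.ty (.truth .prop))) : Tm Γ (.ty (.truth .prop))
  | pointsTo {Γ : TCtx} (M : Tm Γ (.ty .loc)) (N : Tm Γ (.ty .val)) : Tm Γ (.ty (.truth .prop))
  | spec {Γ : TCtx} (S : Tm Γ (.ty (.truth .spec))) : Tm Γ (.ty (.truth .prop))
  | valid {Γ : TCtx} (P : Tm Γ (.ty (.truth .prop))) : Tm Γ (.ty (.truth .spec))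
  | hoare {Γ : TCtx} (P : Tm Γ (.ty (.truth .prop))) (e : Tm Γ (.ty .exp))
      (Q : Tm Γ (.ty (.arrow .val (.truth .prop)))) : Tm Γ (.ty (.truth .spec))
  | trace {Γ : TCtx} (t : Tm Γ (.ty (.seq .val))) : Tm Γ (.ty (.truth .prop))
  | hist {Γ : TCtx} (t : Tm Γ (.ty (.seq .val))) : Tm Γ (.ty (.truth .prop))
  | inv {Γ : TCtx} (I : Tm Γ (.ty (.arrow (.seq .val) (.truth .bool)))) : Tm Γ (.ty (.truth .prop))
  -- programs as terms of type `val` and `exp`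
  | ofPVal {Γ : TCtx} (v : Tm Γ (.pval 0)) : Tm Γ (.ty .val)
  | ofPExp {Γ : TCtx} (e : Tm Γ (.pexp 0)) : Tm Γ (.ty .exp)
  -- program values
  | pvar {Γ : TCtx} {n : ℕ} (i : Fin n) : Tm Γ (.pval n)
  | punit {Γ : TCtx} {n : ℕ} : Tm Γ (.pval n)
  | pint {Γ : TCtx} {n : ℕ} (z : ℤ) : Tm Γ (.pval n)
  | ploc {Γ : TCtx} {n : ℕ} (l : Tm Γ (.ty .loc)) : Tm Γ (.pval n)
  | pfn {Γ : TCtx} {n : ℕ} (f : FunName) : Tm Γ (.pval n)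
  | ppair {Γ : TCtx} {n : ℕ} (u v : Tm Γ (.pval n)) : Tm Γ (.pval n)
  | pterm {Γ : TCtx} {n : ℕ} (M : Tm Γ (.ty .val)) : Tm Γ (.pval n)
  -- program expressions
  | evalue {Γ : TCtx} {n : ℕ} (v : Tm Γ (.pval n)) : Tm Γ (.pexp n)
  | elam {Γ : TCtx} {n : ℕ} (e : Tm Γ (.pexp (n + 1))) : Tm Γ (.pexp n)
  | eapp {Γ : TCtx} {n : ℕ} (e e' : Tm Γ (.pexp n)) : Tm Γ (.pexp n)
  | eite {Γ : TCtx} {n : ℕ} (e e₁ e₂ : Tm Γ (.pexp n)) : Tm Γ (.pexp n)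
  | epair {Γ : TCtx} {n : ℕ} (e e' : Tm Γ (.pexp n)) : Tm Γ (.pexp n)
  | efst {Γ : TCtx} {n : ℕ} (e : Tm Γ (.pexp n)) : Tm Γ (.pexp n)
  | esnd {Γ : TCtx} {n : ℕ} (e : Tm Γ (.pexp n)) : Tm Γ (.pexp n)
  | eref {Γ : TCtx} {n : ℕ} (e : Tm Γ (.pexp n)) : Tm Γ (.pexp n)
  | ederef {Γ : TCtx} {n : ℕ} (e : Tm Γ (.pexp n)) : Tm Γ (.pexp n)
  | ebinop {Γ : TCtx} {n : ℕ} (o : Op) (e e' : Tm Γ (.pexp n)) : Tm Γ (.pexp n)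
  | eemit {Γ : TCtx} {n : ℕ} (v : Tm Γ (.pval n)) : Tm Γ (.pexp n)
  | eterm {Γ : TCtx} {n : ℕ} (M : Tm Γ (.ty .exp)) : Tm Γ (.pexp n)

/-- Terms `Γ ⊢ M : τ`. -/
abbrev Term (Γ : TCtx) (τ : Ty) := Tm Γ (.ty τ)

@[reducible]
def Cls.denote : Cls → Type
  | .ty τ => τ.denote
  | .pval n => Value n
  | .pexp n => Expr n

/-- Variable environments. -/
abbrev Env (Γ : TCtx) := ∀ τ, Var Γ τ → τ.denote

def Env.nil : Env [] := fun _ x => nomatch x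

def Env.cons {Γ : TCtx} {σ : Ty} (a : σ.denote) (ρ : Env Γ) : Env (σ :: Γ)
  | _, .zero => a
  | _, .succ x => ρ _ x

/-- The interpretation of terms; on program expressions it is `e ↦ ρ(e)`. -/
noncomputable def Tm.denote : {Γ : TCtx} → {c : Cls} → Tm Γ c → Env Γ → c.denote
  | _, _, .var x, ρ => ρ _ x
  | _, _, .lam M, ρ => fun a => M.denote (ρ.cons a)
  | _, _, .app M N, ρ => M.denote ρ (N.denote ρ)
  | _, _, .unit, _ => ()
  | _, _, .pair M N, ρ => (M.denote ρ, N.denote ρ)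
  | _, _, .fst M, ρ => (M.denote ρ).1
  | _, _, .snd M, ρ => (M.denote ρ).2
  | _, _, .ite M N₁ N₂, ρ => bif M.denote ρ then N₁.denote ρ else N₂.denote ρ
  | _, _, .zero, _ => Nat.zero
  | _, _, .succ M, ρ => Nat.succ (M.denote ρ)
  | _, _, .natrec M N₁ N₂, ρ =>
      Nat.rec (N₁.denote ρ) (fun n a => N₂.denote ρ (a, n)) (M.denote ρ : ℕ)
  | _, _, .nil, _ => []
  | _, _, .cons M N, ρ => List.cons (M.denote ρ) (N.denote ρ)
  | _, _, .fold M N₁ N₂, ρ => List.foldr (fun x a => N₂.denote ρ (a, x)) (N₁.denote ρ) (M.denote ρ)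
  | _, _, .loc l, _ => l
  | _, _, .bot k, _ => k.bot
  | _, _, .top k, _ => k.top
  | _, _, @Tm.and _ k P Q, ρ => k.and (P.denote ρ) (Q.denote ρ)
  | _, _, @Tm.or _ k P Q, ρ => k.or (P.denote ρ) (Q.denote ρ)
  | _, _, @Tm.imp _ k P Q, ρ => k.imp (P.denote ρ) (Q.denote ρ)
  | _, _, @Tm.all _ k τ P, ρ => k.all (fun a : τ.denote => P.denote (ρ.cons a))
  | _, _, @Tm.ex _ k τ P, ρ => k.ex (fun a : τ.denote => P.denote (ρ.cons a))
  | _, _, @Tm.eq _ k τ M N, ρ => k.eq (α := τ.denote) (M.denote ρ) (N.denote ρ)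
  | _, _, .emp, _ => Kind.top .prop
  | _, _, .star P Q, ρ => SemProp.star (P.denote ρ) (Q.denote ρ)
  | _, _, .wand P Q, ρ => SemProp.wand (P.denote ρ) (Q.denote ρ)
  | _, _, .pointsTo M N, ρ => SemProp.pointsTo (M.denote ρ) (N.denote ρ)
  | _, _, .spec S, ρ => SemProp.pure (SemSpec.holds (S.denote ρ)) (SemSpec.mono (S.denote ρ))
  | _, _, .valid P, ρ => SemSpec.valid (P.denote ρ)
  | _, _, .hoare P e Q, ρ => SemSpec.hoare (P.denote ρ) (e.denote ρ) (Q.denote ρ)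
  | _, _, .trace t, ρ => SemProp.tracing (.trace (t.denote ρ))
  | _, _, .hist t, ρ => SemProp.tracing (.hist (t.denote ρ))
  | _, _, .inv I, ρ => SemProp.pure (fun w => w.inv = {t | I.denote ρ t = true})
      (fun h hw => h.2 ▸ hw)
  | _, _, .ofPVal v, ρ => v.denote ρ
  | _, _, .ofPExp e, ρ => e.denote ρ
  | _, _, .pvar i, _ => Value.var i
  | _, _, .punit, _ => Value.unit
  | _, _, .pint z, _ => Value.int z
  | _, _, .ploc l, ρ => Value.loc (l.denote ρ)
  | _, _, .pfn f, _ => Value.fn f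
  | _, _, .ppair u v, ρ => Value.pair (u.denote ρ) (v.denote ρ)
  | _, _, .pterm M, ρ => Value.wk (M.denote ρ)
  | _, _, .evalue v, ρ => Value.toExpr (v.denote ρ)
  | _, _, .elam e, ρ => Expr.lam (e.denote ρ)
  | _, _, .eapp e e', ρ => Expr.app (e.denote ρ) (e'.denote ρ)
  | _, _, .eite e e₁ e₂, ρ => Expr.ite (e.denote ρ) (e₁.denote ρ) (e₂.denote ρ)
  | _, _, .epair e e', ρ => Expr.pair (e.denote ρ) (e'.denote ρ)
  | _, _, .efst e, ρ => Expr.fst (e.denote ρ)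
  | _, _, .esnd e, ρ => Expr.snd (e.denote ρ)
  | _, _, .eref e, ρ => Expr.ref (e.denote ρ)
  | _, _, .ederef e, ρ => Expr.deref (e.denote ρ)
  | _, _, .ebinop o e e', ρ => Expr.binop o (e.denote ρ) (e'.denote ρ)
  | _, _, .eemit v, ρ => Expr.emit (v.denote ρ)
  | _, _, .eterm M, ρ => Expr.subst (M.denote ρ) PSub.empty

/-! ## Renaming and substitution -/

/-- Renamings. -/
abbrev Ren (Γ Δ : TCtx) := ∀ τ, Var Γ τ → Var Δ τ

def Ren.up {Γ Δ : TCtx} {σ : Ty} (r : Ren Γ Δ) : Ren (σ :: Γ) (σ :: Δ)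
  | _, .zero => .zero
  | _, .succ x => .succ (r _ x)

def Tm.rename : {Γ : TCtx} → {c : Cls} → Tm Γ c → {Δ : TCtx} → Ren Γ Δ → Tm Δ c
  | _, _, .var x, _, r => .var (r _ x)
  | _, _, .lam M, _, r => .lam (M.rename r.up)
  | _, _, .app M N, _, r => .app (M.rename r) (N.rename r)
  | _, _, .unit, _, _ => .unit
  | _, _, .pair M N, _, r => .pair (M.rename r) (N.rename r)
  | _, _, .fst M, _, r => .fst (M.rename r)
  | _, _, .snd M, _, r => .snd (M.rename r)
  | _, _, .ite M N₁ N₂, _, r => .ite (M.rename r) (N₁.rename r) (N₂.rename r)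
  | _, _, .zero, _, _ => .zero
  | _, _, .succ M, _, r => .succ (M.rename r)
  | _, _, .natrec M N₁ N₂, _, r => .natrec (M.rename r) (N₁.rename r) (N₂.rename r)
  | _, _, .nil, _, _ => .nil
  | _, _, .cons M N, _, r => .cons (M.rename r) (N.rename r)
  | _, _, .fold M N₁ N₂, _, r => .fold (M.rename r) (N₁.rename r) (N₂.rename r)
  | _, _, .loc l, _, _ => .loc l
  | _, _, .bot k, _, _ => .bot k
  | _, _, .top k, _, _ => .top k
  | _, _, .and P Q, _, r => .and (P.rename r) (Q.rename r)
  | _, _, .or P Q, _, r => .or (P.rename r) (Q.rename r)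
  | _, _, .imp P Q, _, r => .imp (P.rename r) (Q.rename r)
  | _, _, .all τ P, _, r => .all τ (P.rename r.up)
  | _, _, .ex τ P, _, r => .ex τ (P.rename r.up)
  | _, _, .eq k M N, _, r => .eq k (M.rename r) (N.rename r)
  | _, _, .emp, _, _ => .emp
  | _, _, .star P Q, _, r => .star (P.rename r) (Q.rename r)
  | _, _, .wand P Q, _, r => .wand (P.rename r) (Q.rename r)
  | _, _, .pointsTo M N, _, r => .pointsTo (M.rename r) (N.rename r)
  | _, _, .spec S, _, r => .spec (S.rename r)
  | _, _, .valid P, _, r => .valid (P.rename r)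
  | _, _, .hoare P e Q, _, r => .hoare (P.rename r) (e.rename r) (Q.rename r)
  | _, _, .trace t, _, r => .trace (t.rename r)
  | _, _, .hist t, _, r => .hist (t.rename r)
  | _, _, .inv I, _, r => .inv (I.rename r)
  | _, _, .ofPVal v, _, r => .ofPVal (v.rename r)
  | _, _, .ofPExp e, _, r => .ofPExp (e.rename r)
  | _, _, .pvar i, _, _ => .pvar i
  | _, _, .punit, _, _ => .punit
  | _, _, .pint z, _, _ => .pint z
  | _, _, .ploc l, _, r => .ploc (l.rename r)
  | _, _, .pfn f, _, _ => .pfn f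
  | _, _, .ppair u v, _, r => .ppair (u.rename r) (v.rename r)
  | _, _, .pterm M, _, r => .pterm (M.rename r)
  | _, _, .evalue v, _, r => .evalue (v.rename r)
  | _, _, .elam e, _, r => .elam (e.rename r)
  | _, _, .eapp e e', _, r => .eapp (e.rename r) (e'.rename r)
  | _, _, .eite e e₁ e₂, _, r => .eite (e.rename r) (e₁.rename r) (e₂.rename r)
  | _, _, .epair e e', _, r => .epair (e.rename r) (e'.rename r)
  | _, _, .efst e, _, r => .efst (e.rename r)
  | _, _, .esnd e, _, r => .esnd (e.rename r)
  | _, _, .eref e, _, r => .eref (e.rename r)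
  | _, _, .ederef e, _, r => .ederef (e.rename r)
  | _, _, .ebinop o e e', _, r => .ebinop o (e.rename r) (e'.rename r)
  | _, _, .eemit v, _, r => .eemit (v.rename r)
  | _, _, .eterm M, _, r => .eterm (M.rename r)

/-- Weakening by one variable. -/
def Tm.wk {Γ : TCtx} {c : Cls} {σ : Ty} (M : Tm Γ c) : Tm (σ :: Γ) c := M.rename fun _ => .succ

/-- Weakening by one variable below the last one. -/
def Tm.wk' {Γ : TCtx} {c : Cls} {σ τ : Ty} (M : Tm (τ :: Γ) c) : Tm (τ :: σ :: Γ) c :=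
  M.rename (Ren.up fun _ => .succ)

/-- Substitutions. -/
abbrev Sub (Γ Δ : TCtx) := ∀ τ, Var Γ τ → Term Δ τ

def Sub.up {Γ Δ : TCtx} {σ : Ty} (s : Sub Γ Δ) : Sub (σ :: Γ) (σ :: Δ)
  | _, .zero => .var .zero
  | _, .succ x => (s _ x).wk

def Sub.one {Γ : TCtx} {σ : Ty} (N : Term Γ σ) : Sub (σ :: Γ) Γ
  | _, .zero => N
  | _, .succ x => .var x

def Tm.subst : {Γ : TCtx} → {c : Cls} → Tm Γ c → {Δ : TCtx} → Sub Γ Δ → Tm Δ c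
  | _, _, .var x, _, r => r _ x
  | _, _, .lam M, _, r => .lam (M.subst r.up)
  | _, _, .app M N, _, r => .app (M.subst r) (N.subst r)
  | _, _, .unit, _, _ => .unit
  | _, _, .pair M N, _, r => .pair (M.subst r) (N.subst r)
  | _, _, .fst M, _, r => .fst (M.subst r)
  | _, _, .snd M, _, r => .snd (M.subst r)
  | _, _, .ite M N₁ N₂, _, r => .ite (M.subst r) (N₁.subst r) (N₂.subst r)
  | _, _, .zero, _, _ => .zero
  | _, _, .succ M, _, r => .succ (M.subst r)
  | _, _, .natrec M N₁ N₂, _, r => .natrec (M.subst r) (N₁.subst r) (N₂.subst r)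
  | _, _, .nil, _, _ => .nil
  | _, _, .cons M N, _, r => .cons (M.subst r) (N.subst r)
  | _, _, .fold M N₁ N₂, _, r => .fold (M.subst r) (N₁.subst r) (N₂.subst r)
  | _, _, .loc l, _, _ => .loc l
  | _, _, .bot k, _, _ => .bot k
  | _, _, .top k, _, _ => .top k
  | _, _, .and P Q, _, r => .and (P.subst r) (Q.subst r)
  | _, _, .or P Q, _, r => .or (P.subst r) (Q.subst r)
  | _, _, .imp P Q, _, r => .imp (P.subst r) (Q.subst r)
  | _, _, .all τ P, _, r => .all τ (P.subst r.up)
  | _, _, .ex τ P, _, r => .ex τ (P.subst r.up)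
  | _, _, .eq k M N, _, r => .eq k (M.subst r) (N.subst r)
  | _, _, .emp, _, _ => .emp
  | _, _, .star P Q, _, r => .star (P.subst r) (Q.subst r)
  | _, _, .wand P Q, _, r => .wand (P.subst r) (Q.subst r)
  | _, _, .pointsTo M N, _, r => .pointsTo (M.subst r) (N.subst r)
  | _, _, .spec S, _, r => .spec (S.subst r)
  | _, _, .valid P, _, r => .valid (P.subst r)
  | _, _, .hoare P e Q, _, r => .hoare (P.subst r) (e.subst r) (Q.subst r)
  | _, _, .trace t, _, r => .trace (t.subst r)
  | _, _, .hist t, _, r => .hist (t.subst r)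
  | _, _, .inv I, _, r => .inv (I.subst r)
  | _, _, .ofPVal v, _, r => .ofPVal (v.subst r)
  | _, _, .ofPExp e, _, r => .ofPExp (e.subst r)
  | _, _, .pvar i, _, _ => .pvar i
  | _, _, .punit, _, _ => .punit
  | _, _, .pint z, _, _ => .pint z
  | _, _, .ploc l, _, r => .ploc (l.subst r)
  | _, _, .pfn f, _, _ => .pfn f
  | _, _, .ppair u v, _, r => .ppair (u.subst r) (v.subst r)
  | _, _, .pterm M, _, r => .pterm (M.subst r)
  | _, _, .evalue v, _, r => .evalue (v.subst r)
  | _, _, .elam e, _, r => .elam (e.subst r)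
  | _, _, .eapp e e', _, r => .eapp (e.subst r) (e'.subst r)
  | _, _, .eite e e₁ e₂, _, r => .eite (e.subst r) (e₁.subst r) (e₂.subst r)
  | _, _, .epair e e', _, r => .epair (e.subst r) (e'.subst r)
  | _, _, .efst e, _, r => .efst (e.subst r)
  | _, _, .esnd e, _, r => .esnd (e.subst r)
  | _, _, .eref e, _, r => .eref (e.subst r)
  | _, _, .ederef e, _, r => .ederef (e.subst r)
  | _, _, .ebinop o e e', _, r => .ebinop o (e.subst r) (e'.subst r)
  | _, _, .eemit v, _, r => .eemit (v.subst r)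
  | _, _, .eterm M, _, r => .eterm (M.subst r)

/-- `M[N/x]` for the last variable `x`. -/
def Tm.inst {Γ : TCtx} {c : Cls} {σ : Ty} (M : Tm (σ :: Γ) c) (N : Term Γ σ) : Tm Γ c :=
  M.subst (Sub.one N)

/-- The number of program variables in scope. -/
@[reducible]
def Cls.depth : Cls → ℕ
  | .ty _ => 0
  | .pval n => n
  | .pexp n => n

@[reducible]
def Cls.setDepth (m : ℕ) : Cls → Cls
  | .ty τ => .ty τ
  | .pval _ => .pval m
  | .pexp _ => .pexp m

/-- Substitution of terms of type `val` for program variables. -/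
def Tm.psubst {Γ : TCtx} : {c : Cls} → Tm Γ c → {m : ℕ} → PSub (Term Γ .val) c.depth m →
    Tm Γ (c.setDepth m)
  | .ty _, M, _, _ => M
  | .pval _, .pvar i, _, σ => (σ i).elim .pvar .pterm
  | .pval _, .punit, _, _ => .punit
  | .pval _, .pint z, _, _ => .pint z
  | .pval _, .ploc l, _, _ => .ploc l
  | .pval _, .pfn f, _, _ => .pfn f
  | .pval _, .ppair u v, _, σ => .ppair (u.psubst σ) (v.psubst σ)
  | .pval _, .pterm M, _, _ => .pterm M
  | .pexp _, .evalue v, _, σ => .evalue (v.psubst σ)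
  | .pexp _, .elam e, _, σ => .elam (e.psubst (PSub.up σ))
  | .pexp _, .eapp e e', _, σ => .eapp (e.psubst σ) (e'.psubst σ)
  | .pexp _, .eite e e₁ e₂, _, σ => .eite (e.psubst σ) (e₁.psubst σ) (e₂.psubst σ)
  | .pexp _, .epair e e', _, σ => .epair (e.psubst σ) (e'.psubst σ)
  | .pexp _, .efst e, _, σ => .efst (e.psubst σ)
  | .pexp _, .esnd e, _, σ => .esnd (e.psubst σ)
  | .pexp _, .eref e, _, σ => .eref (e.psubst σ)
  | .pexp _, .ederef e, _, σ => .ederef (e.psubst σ)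
  | .pexp _, .ebinop o e e', _, σ => .ebinop o (e.psubst σ) (e'.psubst σ)
  | .pexp _, .eemit v, _, σ => .eemit (v.psubst σ)
  | .pexp _, .eterm M, _, _ => .eterm M

/-- A program value as an expression, with a pair of values displayed as a pair of expressions. -/
def Tm.expand {Γ : TCtx} : {c : Cls} → Tm Γ c → Tm Γ (.pexp c.depth)
  | .pval _, .ppair u v => .epair u.expand v.expand
  | .pval _, v => .evalue v
  | .pexp _, e => e
  | .ty _, _ => .evalue .punit

/-- The same program with nested quotations `pterm (ofPVal v)` and `eterm (ofPExp e)` removed and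
pairs of values displayed as pairs of expressions. -/
def Tm.flatten {Γ : TCtx} : {c : Cls} → Tm Γ c → Tm Γ c
  | .ty .val, .ofPVal v => .ofPVal v.flatten
  | .ty .exp, .ofPExp e => .ofPExp e.flatten
  | .ty _, M => M
  | .pval _, .pvar i => .pvar i
  | .pval _, .punit => .punit
  | .pval _, .pint z => .pint z
  | .pval _, .ploc l => .ploc l
  | .pval _, .pfn f => .pfn f
  | .pval _, .ppair u v => .ppair u.flatten v.flatten
  | .pval n, .pterm M =>
      match M.flatten with
      | .ofPVal v => v.psubst (m := n) PSub.empty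
      | M' => .pterm M'
  | .pexp _, .evalue v => v.flatten.expand
  | .pexp _, .elam e => .elam e.flatten
  | .pexp _, .eapp e e' => .eapp e.flatten e'.flatten
  | .pexp _, .eite e e₁ e₂ => .eite e.flatten e₁.flatten e₂.flatten
  | .pexp _, .epair e e' => .epair e.flatten e'.flatten
  | .pexp _, .efst e => .efst e.flatten
  | .pexp _, .esnd e => .esnd e.flatten
  | .pexp _, .eref e => .eref e.flatten
  | .pexp _, .ederef e => .ederef e.flatten
  | .pexp _, .ebinop o e e' => .ebinop o e.flatten e'.flatten
  | .pexp _, .eemit v => .eemit v.flatten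
  | .pexp n, .eterm M =>
      match M.flatten with
      | .ofPExp e => e.psubst (m := n) PSub.empty
      | M' => .eterm M'

/-! ## Abbreviations -/

section Abbreviations

variable {Γ : TCtx}

/-- A term of type `val` as a program expression. -/
abbrev Tm.valE {n : ℕ} (v : Term Γ .val) : Tm Γ (.pexp n) := .evalue (.pterm v)

abbrev Tm.unitV : Term Γ .val := .ofPVal .punit
abbrev Tm.intV (z : ℤ) : Term Γ .val := .ofPVal (.pint z)
abbrev Tm.locV (l : Term Γ .loc) : Term Γ .val := .ofPVal (.ploc l)
abbrev Tm.fnV (f : FunName) : Term Γ .val := .ofPVal (.pfn f)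
abbrev Tm.pairV (u v : Term Γ .val) : Term Γ .val := .ofPVal (.ppair (.pterm u) (.pterm v))

/-- `e₁; e₂`, that is `(λ _. e₂) e₁`. -/
def Tm.seqE (e₁ e₂ : Term Γ .exp) : Term Γ .exp :=
  .ofPExp (.eapp (.elam (.eterm e₂)) (.eterm e₁))

/-- A postcondition that does not mention the returned value. -/
def Tm.post (Q : Term Γ .prop) : Term Γ (.arrow .val .prop) := .lam Q.wk

/-- The specification `b = true`. -/
def Tm.holds (b : Term Γ .bool) : Term Γ .spec := .eq .spec b (.top .bool)

def Tm.iff {k : Kind} (P Q : Term Γ (.truth k)) : Term Γ (.truth k) := .and (.imp P Q) (.imp Q P)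

/-- Concatenation of sequences. -/
def Tm.append {τ : Ty} (M N : Term Γ (.seq τ)) : Term Γ (.seq τ) :=
  .fold M N (.lam (.cons (.snd (.var .zero)) (.fst (.var .zero))))

/-- `M ≤ N` in the prefix order. -/
def Tm.isPrefix {τ : Ty} (M N : Term Γ (.seq τ)) : Term Γ .prop :=
  .ex (.seq τ) (.eq .prop (.append M.wk (.var .zero)) N.wk)

/-- `t · v`. -/
def Tm.snoc {τ : Ty} (t : Term Γ (.seq τ)) (v : Term Γ τ) : Term Γ (.seq τ) :=
  .append t (.cons v .nil)

end Abbreviations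

/-- Evaluation contexts over terms. -/
inductive KCtx (Γ : TCtx) : Type
  | hole
  | appL (K : KCtx Γ) (e : Term Γ .exp)
  | appR (v : Term Γ .val) (K : KCtx Γ)
  | opL (o : Op) (K : KCtx Γ) (e : Term Γ .exp)
  | opR (o : Op) (v : Term Γ .val) (K : KCtx Γ)
  | ite (K : KCtx Γ) (e₁ e₂ : Term Γ .exp)
  | pairL (K : KCtx Γ) (e : Term Γ .exp)
  | pairR (v : Term Γ .val) (K : KCtx Γ)
  | fst (K : KCtx Γ)
  | snd (K : KCtx Γ)
  | ref (K : KCtx Γ)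
  | deref (K : KCtx Γ)

def KCtx.fill {Γ : TCtx} : KCtx Γ → Term Γ .exp → Tm Γ (.pexp 0)
  | .hole, a => .eterm a
  | .appL K e, a => .eapp (K.fill a) (.eterm e)
  | .appR v K, a => .eapp (.valE v) (K.fill a)
  | .opL o K e, a => .ebinop o (K.fill a) (.eterm e)
  | .opR o v K, a => .ebinop o (.valE v) (K.fill a)
  | .ite K e₁ e₂, a => .eite (K.fill a) (.eterm e₁) (.eterm e₂)
  | .pairL K e, a => .epair (K.fill a) (.eterm e)
  | .pairR v K, a => .epair (.valE v) (K.fill a)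
  | .fst K, a => .efst (K.fill a)
  | .snd K, a => .esnd (K.fill a)
  | .ref K, a => .eref (K.fill a)
  | .deref K, a => .ederef (K.fill a)

def KCtx.wk {Γ : TCtx} {σ : Ty} : KCtx Γ → KCtx (σ :: Γ)
  | .hole => .hole
  | .appL K e => .appL K.wk e.wk
  | .appR v K => .appR v.wk K.wk
  | .opL o K e => .opL o K.wk e.wk
  | .opR o v K => .opR o v.wk K.wk
  | .ite K e₁ e₂ => .ite K.wk e₁.wk e₂.wk
  | .pairL K e => .pairL K.wk e.wk
  | .pairR v K => .pairR v.wk K.wk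
  | .fst K => .fst K.wk
  | .snd K => .snd K.wk
  | .ref K => .ref K.wk
  | .deref K => .deref K.wk

/-- The outermost form of a program value. -/
inductive VTag : Type
  | unit | int (z : ℤ) | loc | fn (f : FunName) | pair

def Tm.vtag {Γ : TCtx} : {c : Cls} → Tm Γ c → Option VTag
  | .pval _, .punit => some .unit
  | .pval _, .pint z => some (.int z)
  | .pval _, .ploc _ => some .loc
  | .pval _, .pfn f => some (.fn f)
  | .pval _, .ppair _ _ => some .pair
  | _, _ => none

/-! ## The proof system -/

/-- The computation rules of the term language. -/
inductive Conv : {Γ : TCtx} → {τ : Ty} → Term Γ τ → Term Γ τ → Prop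
  | beta {Γ : TCtx} {σ τ : Ty} (M : Term (σ :: Γ) τ) (N : Term Γ σ) :
      Conv (.app (.lam M) N) (M.inst N)
  | eta {Γ : TCtx} {σ τ : Ty} (M : Term Γ (.arrow σ τ)) :
      Conv M (.lam (.app M.wk (.var .zero)))
  | fst {Γ : TCtx} {σ τ : Ty} (M : Term Γ σ) (N : Term Γ τ) : Conv (.fst (.pair M N)) M
  | snd {Γ : TCtx} {σ τ : Ty} (M : Term Γ σ) (N : Term Γ τ) : Conv (.snd (.pair M N)) N
  | pairEta {Γ : TCtx} {σ τ : Ty} (M : Term Γ (.prod σ τ)) : Conv M (.pair (.fst M) (.snd M))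
  | unitEta {Γ : TCtx} (M : Term Γ .unit) : Conv M .unit
  | iteTrue {Γ : TCtx} {τ : Ty} (M N : Term Γ τ) : Conv (.ite (.top .bool) M N) M
  | iteFalse {Γ : TCtx} {τ : Ty} (M N : Term Γ τ) : Conv (.ite (.bot .bool) M N) N
  | natrecZero {Γ : TCtx} {σ : Ty} (N₁ : Term Γ σ) (N₂ : Term Γ (.arrow (.prod σ .nat) σ)) :
      Conv (.natrec .zero N₁ N₂) N₁
  | natrecSucc {Γ : TCtx} {σ : Ty} (M : Term Γ .nat) (N₁ : Term Γ σ)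
      (N₂ : Term Γ (.arrow (.prod σ .nat) σ)) :
      Conv (.natrec (.succ M) N₁ N₂) (.app N₂ (.pair (.natrec M N₁ N₂) M))
  | foldNil {Γ : TCtx} {σ τ : Ty} (N₁ : Term Γ σ) (N₂ : Term Γ (.arrow (.prod σ τ) σ)) :
      Conv (.fold .nil N₁ N₂) N₁
  | foldCons {Γ : TCtx} {σ τ : Ty} (M : Term Γ τ) (M' : Term Γ (.seq τ)) (N₁ : Term Γ σ)
      (N₂ : Term Γ (.arrow (.prod σ τ) σ)) :
      Conv (.fold (.cons M M') N₁ N₂) (.app N₂ (.pair (.fold M' N₁ N₂) M))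
  | ofPVal {Γ : TCtx} (v : Term Γ .val) : Conv (.ofPVal (.pterm v)) v
  | ofPExp {Γ : TCtx} (e : Term Γ .exp) : Conv (.ofPExp (.eterm e)) e
  | flatten {Γ : TCtx} {τ : Ty} (M : Term Γ τ) : Conv M M.flatten

/-- Judgements in a term context and a context of assumed specifications: specifications, and
entailments between resource assertions. -/
inductive Judg (Γ : TCtx) : Type
  | spec (S : Term Γ .spec)
  | ent (P Q : Term Γ .prop)

def Judg.wk {Γ : TCtx} {σ : Ty} : Judg Γ → Judg (σ :: Γ)
  | .spec S => .spec S.wk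
  | .ent P Q => .ent P.wk Q.wk

/-- Weakening of a context of specifications by a term variable. -/
def wkCtx {Γ : TCtx} {σ : Ty} (Θ : List (Term Γ .spec)) : List (Term (σ :: Γ) .spec) :=
  Θ.map Tm.wk

/-- Derivability: `Deriv Θ (.spec S)` is `Γ | Θ ⊢ S`, and `Deriv Θ (.ent P Q)` is
`Γ | Θ | P ⊢ Q`. -/
inductive Deriv : {Γ : TCtx} → List (Term Γ .spec) → Judg Γ → Prop
  -- structural rules
  | hyp {Γ : TCtx} {Θ : List (Term Γ .spec)} {S : Term Γ .spec} (h : S ∈ Θ) : Deriv Θ (.spec S)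
  | cut {Γ : TCtx} {Θ : List (Term Γ .spec)} {S : Term Γ .spec} {J : Judg Γ}
      (h₁ : Deriv Θ (.spec S)) (h₂ : Deriv (S :: Θ) J) : Deriv Θ J
  | weaken {Γ : TCtx} {Θ Θ' : List (Term Γ .spec)} {J : Judg Γ} (hΘ : Θ ⊆ Θ')
      (h : Deriv Θ J) : Deriv Θ' J
  -- specification logic: intuitionistic higher-order logic
  | topI {Γ : TCtx} {Θ : List (Term Γ .spec)} : Deriv Θ (.spec (.top .spec))
  | botE {Γ : TCtx} {Θ : List (Term Γ .spec)} {J : Judg Γ}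
      (h : Deriv Θ (.spec (.bot .spec))) : Deriv Θ J
  | andI {Γ : TCtx} {Θ : List (Term Γ .spec)} {S T : Term Γ .spec}
      (h₁ : Deriv Θ (.spec S)) (h₂ : Deriv Θ (.spec T)) : Deriv Θ (.spec (.and S T))
  | andE₁ {Γ : TCtx} {Θ : List (Term Γ .spec)} {S T : Term Γ .spec}
      (h : Deriv Θ (.spec (.and S T))) : Deriv Θ (.spec S)
  | andE₂ {Γ : TCtx} {Θ : List (Term Γ .spec)} {S T : Term Γ .spec}
      (h : Deriv Θ (.spec (.and S T))) : Deriv Θ (.spec T)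
  | orI₁ {Γ : TCtx} {Θ : List (Term Γ .spec)} {S T : Term Γ .spec}
      (h : Deriv Θ (.spec S)) : Deriv Θ (.spec (.or S T))
  | orI₂ {Γ : TCtx} {Θ : List (Term Γ .spec)} {S T : Term Γ .spec}
      (h : Deriv Θ (.spec T)) : Deriv Θ (.spec (.or S T))
  | orE {Γ : TCtx} {Θ : List (Term Γ .spec)} {S T : Term Γ .spec} {J : Judg Γ}
      (h : Deriv Θ (.spec (.or S T))) (h₁ : Deriv (S :: Θ) J) (h₂ : Deriv (T :: Θ) J) : Deriv Θ J
  | impI {Γ : TCtx} {Θ : List (Term Γ .spec)} {S T : Term Γ .spec}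
      (h : Deriv (S :: Θ) (.spec T)) : Deriv Θ (.spec (.imp S T))
  | impE {Γ : TCtx} {Θ : List (Term Γ .spec)} {S T : Term Γ .spec}
      (h₁ : Deriv Θ (.spec (.imp S T))) (h₂ : Deriv Θ (.spec S)) : Deriv Θ (.spec T)
  | allI {Γ : TCtx} {Θ : List (Term Γ .spec)} {τ : Ty} {S : Term (τ :: Γ) .spec}
      (h : Deriv (wkCtx Θ) (.spec S)) : Deriv Θ (.spec (.all τ S))
  | allE {Γ : TCtx} {Θ : List (Term Γ .spec)} {τ : Ty} {S : Term (τ :: Γ) .spec}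
      (h : Deriv Θ (.spec (.all τ S))) (N : Term Γ τ) : Deriv Θ (.spec (S.inst N))
  | exI {Γ : TCtx} {Θ : List (Term Γ .spec)} {τ : Ty} {S : Term (τ :: Γ) .spec} (N : Term Γ τ)
      (h : Deriv Θ (.spec (S.inst N))) : Deriv Θ (.spec (.ex τ S))
  | exE {Γ : TCtx} {Θ : List (Term Γ .spec)} {τ : Ty} {S : Term (τ :: Γ) .spec} {J : Judg Γ}
      (h₁ : Deriv Θ (.spec (.ex τ S))) (h₂ : Deriv (S :: wkCtx Θ) J.wk) : Deriv Θ J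
  -- equality and extensionality
  | eqRefl {Γ : TCtx} {Θ : List (Term Γ .spec)} {τ : Ty} (M : Term Γ τ) :
      Deriv Θ (.spec (.eq .spec M M))
  | eqSubst {Γ : TCtx} {Θ : List (Term Γ .spec)} {τ : Ty} {M N : Term Γ τ}
      (S : Term (τ :: Γ) .spec) (h₁ : Deriv Θ (.spec (.eq .spec M N)))
      (h₂ : Deriv Θ (.spec (S.inst M))) : Deriv Θ (.spec (S.inst N))
  | conv {Γ : TCtx} {Θ : List (Term Γ .spec)} {τ : Ty} {M N : Term Γ τ} (h : Conv M N) :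
      Deriv Θ (.spec (.eq .spec M N))
  | funExt {Γ : TCtx} {Θ : List (Term Γ .spec)} {σ τ : Ty} {M N : Term Γ (.arrow σ τ)}
      (h : Deriv (wkCtx Θ) (.spec (.eq .spec (.app M.wk (.var (.zero (τ := σ))))
        (.app N.wk (.var .zero))))) : Deriv Θ (.spec (.eq .spec M N))
  | specExt {Γ : TCtx} {Θ : List (Term Γ .spec)} {S T : Term Γ .spec}
      (h : Deriv [] (.spec (.iff S T))) : Deriv Θ (.spec (.eq .spec S T))
  | propExt {Γ : TCtx} {Θ : List (Term Γ .spec)} {P Q : Term Γ .prop}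
      (h₁ : Deriv [] (.ent P Q)) (h₂ : Deriv [] (.ent Q P)) : Deriv Θ (.spec (.eq .spec P Q))
  -- Booleans
  | boolCases {Γ : TCtx} {Θ : List (Term Γ .spec)} (b : Term Γ .bool) :
      Deriv Θ (.spec (.or (.eq .spec b (.top .bool)) (.eq .spec b (.bot .bool))))
  | boolNe {Γ : TCtx} {Θ : List (Term Γ .spec)} {J : Judg Γ}
      (h : Deriv Θ (.spec (.eq .spec (.top .bool) (.bot .bool)))) : Deriv Θ J
  | boolAnd {Γ : TCtx} {Θ : List (Term Γ .spec)} (b c : Term Γ .bool) :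
      Deriv Θ (.spec (.iff (.holds (.and b c)) (.and b.holds c.holds)))
  | boolOr {Γ : TCtx} {Θ : List (Term Γ .spec)} (b c : Term Γ .bool) :
      Deriv Θ (.spec (.iff (.holds (.or b c)) (.or b.holds c.holds)))
  | boolImp {Γ : TCtx} {Θ : List (Term Γ .spec)} (b c : Term Γ .bool) :
      Deriv Θ (.spec (.iff (.holds (.imp b c)) (.imp b.holds c.holds)))
  | boolAll {Γ : TCtx} {Θ : List (Term Γ .spec)} (τ : Ty) (b : Term (τ :: Γ) .bool) :
      Deriv Θ (.spec (.iff (.holds (.all τ b)) (.all τ b.holds)))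
  | boolEx {Γ : TCtx} {Θ : List (Term Γ .spec)} (τ : Ty) (b : Term (τ :: Γ) .bool) :
      Deriv Θ (.spec (.iff (.holds (.ex τ b)) (.ex τ b.holds)))
  | boolEq {Γ : TCtx} {Θ : List (Term Γ .spec)} {τ : Ty} (M N : Term Γ τ) :
      Deriv Θ (.spec (.iff (.holds (.eq .bool M N)) (.eq .spec M N)))
  -- numbers, sequences, locations and values
  | succInj {Γ : TCtx} {Θ : List (Term Γ .spec)} {M N : Term Γ .nat}
      (h : Deriv Θ (.spec (.eq .spec (.succ M) (.succ N)))) : Deriv Θ (.spec (.eq .spec M N))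
  | zeroNe {Γ : TCtx} {Θ : List (Term Γ .spec)} {M : Term Γ .nat} {J : Judg Γ}
      (h : Deriv Θ (.spec (.eq .spec .zero (.succ M)))) : Deriv Θ J
  | natInd {Γ : TCtx} {Θ : List (Term Γ .spec)} (F : Term Γ (.arrow .nat .spec))
      (h₁ : Deriv Θ (.spec (.app F .zero)))
      (h₂ : Deriv Θ (.spec (.all .nat (.imp (.app F.wk (.var .zero))
        (.app F.wk (.succ (.var .zero))))))) :
      Deriv Θ (.spec (.all .nat (.app F.wk (.var .zero))))
  | consInj₁ {Γ : TCtx} {Θ : List (Term Γ .spec)} {τ : Ty} {M M' : Term Γ τ}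
      {N N' : Term Γ (.seq τ)} (h : Deriv Θ (.spec (.eq .spec (.cons M N) (.cons M' N')))) :
      Deriv Θ (.spec (.eq .spec M M'))
  | consInj₂ {Γ : TCtx} {Θ : List (Term Γ .spec)} {τ : Ty} {M M' : Term Γ τ}
      {N N' : Term Γ (.seq τ)} (h : Deriv Θ (.spec (.eq .spec (.cons M N) (.cons M' N')))) :
      Deriv Θ (.spec (.eq .spec N N'))
  | nilNe {Γ : TCtx} {Θ : List (Term Γ .spec)} {τ : Ty} {M : Term Γ τ} {N : Term Γ (.seq τ)}
      {J : Judg Γ} (h : Deriv Θ (.spec (.eq .spec .nil (.cons M N)))) : Deriv Θ J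
  | seqInd {Γ : TCtx} {Θ : List (Term Γ .spec)} {τ : Ty} (F : Term Γ (.arrow (.seq τ) .spec))
      (h₁ : Deriv Θ (.spec (.app F .nil)))
      (h₂ : Deriv Θ (.spec (.all (.seq τ) (.all τ (.imp (.app F.wk.wk (.var (.succ .zero)))
        (.app F.wk.wk (.cons (.var .zero) (.var (.succ .zero))))))))) :
      Deriv Θ (.spec (.all (.seq τ) (.app F.wk (.var .zero))))
  | locNe {Γ : TCtx} {Θ : List (Term Γ .spec)} {l l' : Loc} {J : Judg Γ} (hl : l ≠ l')
      (h : Deriv Θ (.spec (.eq .spec (.loc l) (.loc l')))) : Deriv Θ J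
  | valNe {Γ : TCtx} {Θ : List (Term Γ .spec)} {u v : Tm Γ (.pval 0)} {a b : VTag} {J : Judg Γ}
      (hu : u.vtag = some a) (hv : v.vtag = some b) (hab : a ≠ b)
      (h : Deriv Θ (.spec (.eq .spec (.ofPVal u) (.ofPVal v)))) : Deriv Θ J
  | locInj {Γ : TCtx} {Θ : List (Term Γ .spec)} {M N : Term Γ .loc}
      (h : Deriv Θ (.spec (.eq .spec (.locV M) (.locV N)))) : Deriv Θ (.spec (.eq .spec M N))
  | pairInj₁ {Γ : TCtx} {Θ : List (Term Γ .spec)} {u u' v v' : Term Γ .val}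
      (h : Deriv Θ (.spec (.eq .spec (.pairV u v) (.pairV u' v')))) :
      Deriv Θ (.spec (.eq .spec u u'))
  | pairInj₂ {Γ : TCtx} {Θ : List (Term Γ .spec)} {u u' v v' : Term Γ .val}
      (h : Deriv Θ (.spec (.eq .spec (.pairV u v) (.pairV u' v')))) :
      Deriv Θ (.spec (.eq .spec v v'))
  -- assertion logic: intuitionistic higher-order separation logic
  | entRefl {Γ : TCtx} {Θ : List (Term Γ .spec)} (P : Term Γ .prop) : Deriv Θ (.ent P P)
  | entTrans {Γ : TCtx} {Θ : List (Term Γ .spec)} {P Q R : Term Γ .prop}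
      (h₁ : Deriv Θ (.ent P Q)) (h₂ : Deriv Θ (.ent Q R)) : Deriv Θ (.ent P R)
  | entTopI {Γ : TCtx} {Θ : List (Term Γ .spec)} (P : Term Γ .prop) :
      Deriv Θ (.ent P (.top .prop))
  | entBotE {Γ : TCtx} {Θ : List (Term Γ .spec)} (P : Term Γ .prop) :
      Deriv Θ (.ent (.bot .prop) P)
  | entAndI {Γ : TCtx} {Θ : List (Term Γ .spec)} {P Q R : Term Γ .prop}
      (h₁ : Deriv Θ (.ent P Q)) (h₂ : Deriv Θ (.ent P R)) : Deriv Θ (.ent P (.and Q R))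
  | entAndE₁ {Γ : TCtx} {Θ : List (Term Γ .spec)} (P Q : Term Γ .prop) :
      Deriv Θ (.ent (.and P Q) P)
  | entAndE₂ {Γ : TCtx} {Θ : List (Term Γ .spec)} (P Q : Term Γ .prop) :
      Deriv Θ (.ent (.and P Q) Q)
  | entOrI₁ {Γ : TCtx} {Θ : List (Term Γ .spec)} (P Q : Term Γ .prop) :
      Deriv Θ (.ent P (.or P Q))
  | entOrI₂ {Γ : TCtx} {Θ : List (Term Γ .spec)} (P Q : Term Γ .prop) :
      Deriv Θ (.ent Q (.or P Q))
  | entOrE {Γ : TCtx} {Θ : List (Term Γ .spec)} {P Q R : Term Γ .prop}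
      (h₁ : Deriv Θ (.ent P R)) (h₂ : Deriv Θ (.ent Q R)) : Deriv Θ (.ent (.or P Q) R)
  | entImpI {Γ : TCtx} {Θ : List (Term Γ .spec)} {P Q R : Term Γ .prop}
      (h : Deriv Θ (.ent (.and P Q) R)) : Deriv Θ (.ent P (.imp Q R))
  | entImpE {Γ : TCtx} {Θ : List (Term Γ .spec)} {P Q R : Term Γ .prop}
      (h : Deriv Θ (.ent P (.imp Q R))) : Deriv Θ (.ent (.and P Q) R)
  | entAllI {Γ : TCtx} {Θ : List (Term Γ .spec)} {τ : Ty} {P : Term Γ .prop}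
      {Q : Term (τ :: Γ) .prop} (h : Deriv (wkCtx Θ) (.ent P.wk Q)) : Deriv Θ (.ent P (.all τ Q))
  | entAllE {Γ : TCtx} {Θ : List (Term Γ .spec)} {τ : Ty} (P : Term (τ :: Γ) .prop)
      (N : Term Γ τ) : Deriv Θ (.ent (.all τ P) (P.inst N))
  | entExI {Γ : TCtx} {Θ : List (Term Γ .spec)} {τ : Ty} (P : Term (τ :: Γ) .prop)
      (N : Term Γ τ) : Deriv Θ (.ent (P.inst N) (.ex τ P))
  | entExE {Γ : TCtx} {Θ : List (Term Γ .spec)} {τ : Ty} {P : Term (τ :: Γ) .prop}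
      {Q : Term Γ .prop} (h : Deriv (wkCtx Θ) (.ent P Q.wk)) : Deriv Θ (.ent (.ex τ P) Q)
  | starMono {Γ : TCtx} {Θ : List (Term Γ .spec)} {P P' Q Q' : Term Γ .prop}
      (h₁ : Deriv Θ (.ent P P')) (h₂ : Deriv Θ (.ent Q Q')) :
      Deriv Θ (.ent (.star P Q) (.star P' Q'))
  | starComm {Γ : TCtx} {Θ : List (Term Γ .spec)} (P Q : Term Γ .prop) :
      Deriv Θ (.ent (.star P Q) (.star Q P))
  | starAssoc {Γ : TCtx} {Θ : List (Term Γ .spec)} (P Q R : Term Γ .prop) :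
      Deriv Θ (.ent (.star (.star P Q) R) (.star P (.star Q R)))
  | starEmpI {Γ : TCtx} {Θ : List (Term Γ .spec)} (P : Term Γ .prop) :
      Deriv Θ (.ent P (.star P .emp))
  | starEmpE {Γ : TCtx} {Θ : List (Term Γ .spec)} (P : Term Γ .prop) :
      Deriv Θ (.ent (.star P .emp) P)
  | affine {Γ : TCtx} {Θ : List (Term Γ .spec)} (P : Term Γ .prop) : Deriv Θ (.ent P .emp)
  | wandI {Γ : TCtx} {Θ : List (Term Γ .spec)} {P Q R : Term Γ .prop}
      (h : Deriv Θ (.ent (.star P Q) R)) : Deriv Θ (.ent P (.wand Q R))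
  | wandE {Γ : TCtx} {Θ : List (Term Γ .spec)} {P Q R : Term Γ .prop}
      (h : Deriv Θ (.ent P (.wand Q R))) : Deriv Θ (.ent (.star P Q) R)
  | ptsExcl {Γ : TCtx} {Θ : List (Term Γ .spec)} (l : Term Γ .loc) (u v : Term Γ .val) :
      Deriv Θ (.ent (.star (.pointsTo l u) (.pointsTo l v)) (.bot .prop))
  | ptsAgree {Γ : TCtx} {Θ : List (Term Γ .spec)} (l : Term Γ .loc) (u v : Term Γ .val) :
      Deriv Θ (.ent (.and (.pointsTo l u) (.pointsTo l v)) (.eq .prop u v))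
  -- embeddings of the two logics into each other
  | pSpec {Γ : TCtx} {Θ : List (Term Γ .spec)} {S : Term Γ .spec} (h : S ∈ Θ)
      (P : Term Γ .prop) : Deriv Θ (.ent P (.spec S))
  | pValid {Γ : TCtx} {Θ : List (Term Γ .spec)} {Q : Term Γ .prop} (h : .valid Q ∈ Θ)
      (P : Term Γ .prop) : Deriv Θ (.ent P Q)
  | specE {Γ : TCtx} {Θ : List (Term Γ .spec)} {S : Term Γ .spec} {P Q : Term Γ .prop}
      (h : Deriv (S :: Θ) (.ent P Q)) : Deriv Θ (.ent (.and P (.spec S)) Q)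
  | specAll {Γ : TCtx} {Θ : List (Term Γ .spec)} {τ : Ty} (S : Term (τ :: Γ) .spec) :
      Deriv Θ (.ent (.all τ (.spec S)) (.spec (.all τ S)))
  | eqSpec {Γ : TCtx} {Θ : List (Term Γ .spec)} {τ : Ty} (M N : Term Γ τ) :
      Deriv Θ (.ent (.eq .prop M N) (.spec (.eq .spec M N)))
  | specEq {Γ : TCtx} {Θ : List (Term Γ .spec)} {τ : Ty} (M N : Term Γ τ) :
      Deriv Θ (.ent (.spec (.eq .spec M N)) (.eq .prop M N))
  | valid {Γ : TCtx} {Θ : List (Term Γ .spec)} {P : Term Γ .prop}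
      (h : Deriv Θ (.ent .emp P)) : Deriv Θ (.spec (.valid P))
  -- traces
  | pInvDupl {Γ : TCtx} {Θ : List (Term Γ .spec)} (I : Term Γ (.arrow (.seq .val) .bool)) :
      Deriv Θ (.ent (.inv I) (.star (.inv I) (.inv I)))
  | pHistDupl {Γ : TCtx} {Θ : List (Term Γ .spec)} (t : Term Γ (.seq .val)) :
      Deriv Θ (.ent (.hist t) (.star (.hist t) (.hist t)))
  | pUseHist {Γ : TCtx} {Θ : List (Term Γ .spec)} (t₁ t₂ : Term Γ (.seq .val)) :
      Deriv Θ (.ent (.star (.trace t₁) (.hist t₂)) (.star (.trace t₁) (t₂.isPrefix t₁)))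
  | pAllocHist {Γ : TCtx} {Θ : List (Term Γ .spec)} (t : Term Γ (.seq .val)) :
      Deriv Θ (.ent (.trace t) (.star (.trace t) (.hist t)))
  | traceExcl {Γ : TCtx} {Θ : List (Term Γ .spec)} (t t' : Term Γ (.seq .val)) :
      Deriv Θ (.ent (.star (.trace t) (.trace t')) (.bot .prop))
  -- Hoare triples: general rules
  | ret {Γ : TCtx} {Θ : List (Term Γ .spec)} (v : Term Γ .val) :
      Deriv Θ (.spec (.hoare (.top .prop) (.ofPExp (.valE v)) (.lam (.eq .prop (.var .zero) v.wk))))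
  | specOut {Γ : TCtx} {Θ : List (Term Γ .spec)} {S : Term Γ .spec} {P : Term Γ .prop}
      {e : Term Γ .exp} {R : Term Γ (.arrow .val .prop)}
      (h : Deriv (S :: Θ) (.spec (.hoare P e R))) : Deriv Θ (.spec (.hoare (.star P (.spec S)) e R))
  | frame {Γ : TCtx} {Θ : List (Term Γ .spec)} {P : Term Γ .prop} {e : Term Γ .exp}
      {Q : Term Γ (.arrow .val .prop)} (R : Term Γ .prop) (h : Deriv Θ (.spec (.hoare P e Q))) :
      Deriv Θ (.spec (.hoare (.star P R) e (.lam (.star (.app Q.wk (.var .zero)) R.wk))))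
  | bind {Γ : TCtx} {Θ : List (Term Γ .spec)} {P : Term Γ .prop} {e : Term Γ .exp}
      (K : KCtx Γ) {Q : Term (.val :: Γ) .prop} {R : Term (.val :: Γ) (.arrow .val .prop)}
      (h₁ : Deriv Θ (.spec (.hoare P e (.lam Q))))
      (h₂ : Deriv (wkCtx Θ)
        (.spec (.hoare Q (.ofPExp (K.wk.fill (.ofPExp (.valE (.var .zero))))) R))) :
      Deriv Θ (.spec (.hoare P (.ofPExp (K.fill e))
        (.lam (.ex .val (.app R.wk' (.var (.succ .zero)))))))
  | csq {Γ : TCtx} {Θ : List (Term Γ .spec)} {P₁ P₂ : Term Γ .prop} {e : Term Γ .exp}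
      {Q₁ Q₂ : Term Γ (.arrow .val .prop)} (h₁ : Deriv Θ (.ent P₁ P₂))
      (h₂ : Deriv Θ (.spec (.hoare P₂ e Q₂)))
      (h₃ : Deriv (wkCtx Θ) (.ent (.app Q₂.wk (.var .zero)) (.app Q₁.wk (.var .zero)))) :
      Deriv Θ (.spec (.hoare P₁ e Q₁))
  | tripleEx {Γ : TCtx} {Θ : List (Term Γ .spec)} {τ : Ty} {P : Term (τ :: Γ) .prop}
      {e : Term Γ .exp} {Q : Term Γ (.arrow .val .prop)}
      (h : Deriv (wkCtx Θ) (.spec (.hoare P e.wk Q.wk))) : Deriv Θ (.spec (.hoare (.ex τ P) e Q))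
  | tripleOr {Γ : TCtx} {Θ : List (Term Γ .spec)} {P₁ P₂ : Term Γ .prop} {e : Term Γ .exp}
      {Q : Term Γ (.arrow .val .prop)} (h₁ : Deriv Θ (.spec (.hoare P₁ e Q)))
      (h₂ : Deriv Θ (.spec (.hoare P₂ e Q))) : Deriv Θ (.spec (.hoare (.or P₁ P₂) e Q))
  -- Hoare triples: the constructs of the programming language
  | abs {Γ : TCtx} {Θ : List (Term Γ .spec)} {P : Term (.val :: Γ) .prop}
      {Q : Term (.val :: Γ) (.arrow .val .prop)} (e : Tm Γ (.pexp 1))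
      (h : Deriv (wkCtx Θ)
        (.spec (.hoare P (.ofPExp (e.wk.psubst (m := 0) (PSub.one (.var .zero)))) Q))) :
      Deriv Θ (.spec (.hoare .emp (.ofPExp (.elam e)) (.lam (.all .val (.spec (.hoare P.wk'
        (.ofPExp (.eapp (.valE (.var (.succ .zero))) (.valE (.var .zero)))) Q.wk'))))))
  | fst {Γ : TCtx} {Θ : List (Term Γ .spec)} (u v : Term Γ .val) :
      Deriv Θ (.spec (.hoare (.top .prop) (.ofPExp (.efst (.epair (.valE u) (.valE v))))
        (.lam (.eq .prop (.var .zero) u.wk))))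
  | snd {Γ : TCtx} {Θ : List (Term Γ .spec)} (u v : Term Γ .val) :
      Deriv Θ (.spec (.hoare (.top .prop) (.ofPExp (.esnd (.epair (.valE u) (.valE v))))
        (.lam (.eq .prop (.var .zero) v.wk))))
  | itePos {Γ : TCtx} {Θ : List (Term Γ .spec)} {P : Term Γ .prop} {e₁ e₂ : Term Γ .exp}
      {Q : Term Γ (.arrow .val .prop)} {z : ℤ} (hz : 0 < z) (h : Deriv Θ (.spec (.hoare P e₁ Q))) :
      Deriv Θ (.spec (.hoare P
        (.ofPExp (.eite (.valE (.intV z)) (.eterm e₁) (.eterm e₂))) Q))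
  | iteZero {Γ : TCtx} {Θ : List (Term Γ .spec)} {P : Term Γ .prop} {e₁ e₂ : Term Γ .exp}
      {Q : Term Γ (.arrow .val .prop)} (h : Deriv Θ (.spec (.hoare P e₂ Q))) :
      Deriv Θ (.spec (.hoare P
        (.ofPExp (.eite (.valE (.intV 0)) (.eterm e₁) (.eterm e₂))) Q))
  | arith {Γ : TCtx} {Θ : List (Term Γ .spec)} (o : Arith) (a b : ℤ) :
      Deriv Θ (.spec (.hoare (.top .prop)
        (.ofPExp (.ebinop (.arith o) (.valE (.intV a)) (.valE (.intV b))))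
        (.lam (.eq .prop (.var .zero) (.intV (o.eval a b))))))
  | eqTrue {Γ : TCtx} {Θ : List (Term Γ .spec)} {u v : Term Γ .val}
      (h : Deriv Θ (.spec (.eq .spec u v))) :
      Deriv Θ (.spec (.hoare (.top .prop) (.ofPExp (.ebinop .eq (.valE u) (.valE v)))
        (.lam (.eq .prop (.var .zero) (.intV 1)))))
  | eqFalse {Γ : TCtx} {Θ : List (Term Γ .spec)} {u v : Term Γ .val}
      (h : Deriv Θ (.spec (.imp (.eq .spec u v) (.bot .spec)))) :
      Deriv Θ (.spec (.hoare (.top .prop) (.ofPExp (.ebinop .eq (.valE u) (.valE v)))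
        (.lam (.eq .prop (.var .zero) (.intV 0)))))
  | alloc {Γ : TCtx} {Θ : List (Term Γ .spec)} (v : Term Γ .val) :
      Deriv Θ (.spec (.hoare .emp (.ofPExp (.eref (.valE v)))
        (.lam (.ex .loc (.star (.eq .prop (.var (.succ .zero)) (.locV (.var .zero)))
          (.pointsTo (.var .zero) v.wk.wk))))))
  | read {Γ : TCtx} {Θ : List (Term Γ .spec)} (l : Term Γ .loc) (v : Term Γ .val) :
      Deriv Θ (.spec (.hoare (.pointsTo l v) (.ofPExp (.ederef (.valE (.locV l))))
        (.lam (.star (.pointsTo l.wk v.wk) (.eq .prop (.var .zero) v.wk)))))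
  | write {Γ : TCtx} {Θ : List (Term Γ .spec)} (l : Term Γ .loc) (v : Term Γ .val) :
      Deriv Θ (.spec (.hoare (.ex .val (.pointsTo l.wk (.var .zero)))
        (.ofPExp (.ebinop .assign (.valE (.locV l)) (.valE v)))
        (.lam (.star (.pointsTo l.wk v.wk) (.eq .prop (.var .zero) .unitV)))))
  | emit {Γ : TCtx} {Θ : List (Term Γ .spec)} (I : Term Γ (.arrow (.seq .val) .bool))
      (t : Term Γ (.seq .val)) (v : Term Γ .val)
      (h : Deriv Θ (.spec (.holds (.app I (t.snoc v))))) :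
      Deriv Θ (.spec (.hoare (.star (.trace t) (.inv I)) (.ofPExp (.eemit (.pterm v)))
        (.lam (.star (.trace (t.snoc v).wk) (.eq .prop (.var .zero) .unitV)))))

/-- The program denoted by a closed term of type `exp`. -/
noncomputable def Tm.toProgram (e : Term [] .exp) : Exp := e.denote Env.nil

/-- The set of traces denoted by a closed term of type `seq val → bool`. -/
def Tm.language (L : Term [] (.arrow (.seq .val) .bool)) : Set Trace :=
  {t | L.denote Env.nil t = true}

end TraceSL

open TraceSL

namespace TraceSL

/-! ## Substitution in programs -/

/-! The argument is semantic. A world consists of a function environment, which may grow, and a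
trace invariant, which never changes. A resource is a heap together with either a known prefix of
the trace or exclusive ownership of it. A trace and a state realize a resource in a world only if,
among other things, the trace lies in the world's invariant, and `wp` demands that every step lead
to a configuration that again realizes its resource. Safety with respect to the invariant is
therefore built into the meaning of triples, and two facts remain to be shown.

Soundness (`Deriv.sound`): every derivable judgement is true in every world where its hypotheses
hold. The structural rules rest on `wp_frame` and `wp_bind`, proved by coinduction because `wp` is a
greatest fixed point; each language construct has its own `wp` lemma. The invariant matters for
`wp_emit`: owning `trace(t)` identifies the current trace, `inv(I)` identifies the world's invariant
with `I`, and the side condition of the rule says that the extended trace stays in it.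

Adequacy (`wp_adequate`): along a run from a configuration satisfying `wp`, the accumulated trace
stays in the invariant.

For the theorem, take the world with the initial function environment and invariant `L`. The client
is verified for every assertion `P` satisfying the library specification, so `P` may be chosen as
`P₀ * trace(ε) * inv(L)`, which is what the library was verified for. The initialiser knows nothing
of traces; framing `trace(ε) * inv(L)` around its triple yields exactly this `P`. Sequencing
(`wp_seq`) then puts the whole program in `wp`, and adequacy concludes. -/

theorem Value.wk_zero (v : Val) : v.wk = v := by
  induction v with
  | var i => exact i.elim0
  | pair u v hu hv => simp [Value.wk, hu, hv]
  | _ => rfl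

theorem Value.subst_wk {n m : ℕ} (σ : PSub Val n m) (v : Val) : (v.wk).subst σ = v.wk := by
  induction v with
  | var i => exact i.elim0
  | pair u v hu hv => simp [Value.wk, Value.subst, hu, hv]
  | _ => rfl

theorem Value.subst_empty {m : ℕ} (v : Val) : v.subst (PSub.empty (m := m)) = v.wk := by
  induction v with
  | var i => exact i.elim0
  | pair u v hu hv => simp [Value.wk, Value.subst, hu, hv]
  | _ => rfl

theorem Value.toExpr_subst {n m : ℕ} (σ : PSub Val n m) (v : Value n) :
    v.toExpr.subst σ = (v.subst σ).toExpr := by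
  induction v with
  | var i => simp only [Value.toExpr, Expr.subst, Value.subst]; cases σ i <;> rfl
  | pair u v hu hv => simp [Value.toExpr, Value.subst, Expr.subst, hu, hv]
  | _ => rfl

/-- Composition of substitutions for program variables. -/
def PSub.comp {n m k : ℕ} (σ : PSub Val n m) (τ : PSub Val m k) : PSub Val n k :=
  fun i => (σ i).elim τ .inr

theorem PSub.up_comp {n m k : ℕ} (σ : PSub Val n m) (τ : PSub Val m k) :
    (σ.comp τ).up = σ.up.comp τ.up := by
  funext i
  refine Fin.cases rfl (fun i => ?_) i
  simp only [PSub.up, PSub.comp, Fin.cases_succ]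
  cases σ i <;> rfl

theorem Value.subst_subst {n m k : ℕ} (σ : PSub Val n m) (τ : PSub Val m k) (v : Value n) :
    (v.subst σ).subst τ = v.subst (σ.comp τ) := by
  induction v with
  | var i =>
    simp only [Value.subst, PSub.comp]
    cases σ i <;> simp [Value.subst, Value.subst_wk]
  | pair u v hu hv => simp [Value.subst, hu, hv]
  | _ => rfl

theorem Expr.subst_subst {n m k : ℕ} (σ : PSub Val n m) (τ : PSub Val m k) (e : Expr n) :
    (e.subst σ).subst τ = e.subst (σ.comp τ) := by
  induction e generalizing m k with
  | var i =>
    simp only [Expr.subst, PSub.comp]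
    cases σ i <;> simp [Expr.subst, Value.toExpr_subst, Value.subst_wk]
  | lam e ih => simp [Expr.subst, ih, PSub.up_comp]
  | emit v => simp [Expr.subst, Value.subst_subst]
  | _ => simp_all [Expr.subst]

theorem Value.subst_inl {n : ℕ} (v : Value n) : v.subst (fun i => .inl i) = v := by
  induction v <;> simp_all [Value.subst]

theorem Expr.subst_inl {n : ℕ} (e : Expr n) : e.subst (fun i => .inl i) = e := by
  induction e with
  | lam e ih =>
    simp only [Expr.subst]
    rw [show PSub.up (fun i => Sum.inl i) = fun i => Sum.inl i from ?_, ih]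
    funext i
    exact Fin.cases rfl (fun _ => rfl) i
  | emit v => simp [Expr.subst, Value.subst_inl]
  | _ => simp_all [Expr.subst]

/-- Quoting a term of type `exp` inside a program inserts a substitution with empty domain; this
removes it when no program variable is in scope. -/
theorem Expr.subst_closed (σ : PSub Val 0 0) (e : Exp) : e.subst σ = e := by
  rw [show σ = fun i => .inl i from funext fun i => i.elim0, Expr.subst_inl]

/-! ## Inversion of reduction -/

theorem Value.toExpr_injective {n : ℕ} : Function.Injective (Value.toExpr (n := n)) := by
  intro u v h
  induction u generalizing v with
  | pair u u' hu hu' =>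
    cases v <;> simp only [Value.toExpr, reduceCtorEq, Expr.pair.injEq] at h
    rw [hu h.1, hu' h.2]
  | _ => cases v <;> simp_all [Value.toExpr]

theorem Step.head {e e' : Exp} {s s' : State} {a : Option Val} (h : Head e s a e' s') :
    Step e s a e' s' := .ctx .hole h

theorem Step.exists_ctx {e e' : Exp} {s s' : State} {a : Option Val} (h : Step e s a e' s') :
    ∃ K x x', e = ECtx.fill K x ∧ e' = ECtx.fill K x' ∧ Head x s a x' s' := by
  obtain ⟨K, h⟩ := h
  exact ⟨K, _, _, rfl, rfl, h⟩

/-- The evaluation context is either empty or has one of the two application frames outermost. The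
inversion lemmas for the other constructors follow the same pattern. -/
theorem Step.app_inv {e₁ e₂ e' : Exp} {s s' : State} {a : Option Val}
    (h : Step (.app e₁ e₂) s a e' s') : Head (.app e₁ e₂) s a e' s' ∨
      (∃ x, Step e₁ s a x s' ∧ e' = .app x e₂) ∨
      ∃ v : Val, ∃ x, e₁ = v.toExpr ∧ Step e₂ s a x s' ∧ e' = .app e₁ x := by
  generalize he : Expr.app e₁ e₂ = e at h
  obtain ⟨K, h⟩ := h
  cases K <;> simp only [ECtx.fill, reduceCtorEq, Expr.app.injEq] at he
  · subst he; exact .inl h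
  · obtain ⟨rfl, rfl⟩ := he; exact .inr (.inl ⟨_, ⟨_, h⟩, rfl⟩)
  · obtain ⟨rfl, rfl⟩ := he; exact .inr (.inr ⟨_, _, rfl, ⟨_, h⟩, rfl⟩)

theorem Step.binop_inv {o : Op} {e₁ e₂ e' : Exp} {s s' : State} {a : Option Val}
    (h : Step (.binop o e₁ e₂) s a e' s') : Head (.binop o e₁ e₂) s a e' s' ∨
      (∃ x, Step e₁ s a x s' ∧ e' = .binop o x e₂) ∨
      ∃ v : Val, ∃ x, e₁ = v.toExpr ∧ Step e₂ s a x s' ∧ e' = .binop o e₁ x := by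
  generalize he : Expr.binop o e₁ e₂ = e at h
  obtain ⟨K, h⟩ := h
  cases K <;> simp only [ECtx.fill, reduceCtorEq, Expr.binop.injEq] at he
  · subst he; exact .inl h
  · obtain ⟨rfl, rfl, rfl⟩ := he; exact .inr (.inl ⟨_, ⟨_, h⟩, rfl⟩)
  · obtain ⟨rfl, rfl, rfl⟩ := he; exact .inr (.inr ⟨_, _, rfl, ⟨_, h⟩, rfl⟩)

/-- There is no head alternative because a pair is never itself a redex. -/
theorem Step.pair_inv {e₁ e₂ e' : Exp} {s s' : State} {a : Option Val}
    (h : Step (.pair e₁ e₂) s a e' s') : (∃ x, Step e₁ s a x s' ∧ e' = .pair x e₂) ∨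
      ∃ v : Val, ∃ x, e₁ = v.toExpr ∧ Step e₂ s a x s' ∧ e' = .pair e₁ x := by
  generalize he : Expr.pair e₁ e₂ = e at h
  obtain ⟨K, h⟩ := h
  cases K <;> simp only [ECtx.fill, reduceCtorEq, Expr.pair.injEq] at he
  · subst he; cases h
  · obtain ⟨rfl, rfl⟩ := he; exact .inl ⟨_, ⟨_, h⟩, rfl⟩
  · obtain ⟨rfl, rfl⟩ := he; exact .inr ⟨_, _, rfl, ⟨_, h⟩, rfl⟩

theorem Step.ite_inv {e e₁ e₂ e' : Exp} {s s' : State} {a : Option Val}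
    (h : Step (.ite e e₁ e₂) s a e' s') : Head (.ite e e₁ e₂) s a e' s' ∨
      ∃ x, Step e s a x s' ∧ e' = .ite x e₁ e₂ := by
  generalize he : Expr.ite e e₁ e₂ = e₀ at h
  obtain ⟨K, h⟩ := h
  cases K <;> simp only [ECtx.fill, reduceCtorEq, Expr.ite.injEq] at he
  · subst he; exact .inl h
  · obtain ⟨rfl, rfl, rfl⟩ := he; exact .inr ⟨_, ⟨_, h⟩, rfl⟩

theorem Step.fst_inv {e e' : Exp} {s s' : State} {a : Option Val}
    (h : Step (.fst e) s a e' s') : Head (.fst e) s a e' s' ∨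
      ∃ x, Step e s a x s' ∧ e' = .fst x := by
  generalize he : Expr.fst e = e₀ at h
  obtain ⟨K, h⟩ := h
  cases K <;> simp only [ECtx.fill, reduceCtorEq, Expr.fst.injEq] at he
  · subst he; exact .inl h
  · subst he; exact .inr ⟨_, ⟨_, h⟩, rfl⟩

theorem Step.snd_inv {e e' : Exp} {s s' : State} {a : Option Val}
    (h : Step (.snd e) s a e' s') : Head (.snd e) s a e' s' ∨
      ∃ x, Step e s a x s' ∧ e' = .snd x := by
  generalize he : Expr.snd e = e₀ at h
  obtain ⟨K, h⟩ := h
  cases K <;> simp only [ECtx.fill, reduceCtorEq, Expr.snd.injEq] at he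
  · subst he; exact .inl h
  · subst he; exact .inr ⟨_, ⟨_, h⟩, rfl⟩

theorem Step.ref_inv {e e' : Exp} {s s' : State} {a : Option Val}
    (h : Step (.ref e) s a e' s') : Head (.ref e) s a e' s' ∨
      ∃ x, Step e s a x s' ∧ e' = .ref x := by
  generalize he : Expr.ref e = e₀ at h
  obtain ⟨K, h⟩ := h
  cases K <;> simp only [ECtx.fill, reduceCtorEq, Expr.ref.injEq] at he
  · subst he; exact .inl h
  · subst he; exact .inr ⟨_, ⟨_, h⟩, rfl⟩

theorem Step.deref_inv {e e' : Exp} {s s' : State} {a : Option Val}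
    (h : Step (.deref e) s a e' s') : Head (.deref e) s a e' s' ∨
      ∃ x, Step e s a x s' ∧ e' = .deref x := by
  generalize he : Expr.deref e = e₀ at h
  obtain ⟨K, h⟩ := h
  cases K <;> simp only [ECtx.fill, reduceCtorEq, Expr.deref.injEq] at he
  · subst he; exact .inl h
  · subst he; exact .inr ⟨_, ⟨_, h⟩, rfl⟩

/-- A context can enter a value only through a pair, whose components are again values; every other
value forces the empty context and matches no redex. -/
theorem Value.not_step (v : Val) {e' : Exp} {s s' : State} {a : Option Val} :
    ¬ Step v.toExpr s a e' s' := by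
  intro h
  induction v generalizing e' with
  | var i => exact i.elim0
  | pair u v hu hv =>
    rcases Step.pair_inv h with ⟨x, hx, -⟩ | ⟨_, x, -, hx, -⟩
    · exact hu hx
    · exact hv hx
  | _ =>
    obtain ⟨K, x, x', he, -, h⟩ := h.exists_ctx
    cases K <;> simp only [ECtx.fill, Value.toExpr, reduceCtorEq] at he
    subst he
    cases h

theorem Value.stuck (v : Val) (s : State) : Stuck v.toExpr s := fun _ _ _ h => v.not_step h

theorem Step.lam_inv {b : Expr 1} {e' : Exp} {s s' : State} {a : Option Val}
    (h : Step (.lam b) s a e' s') : Head (.lam b) s a e' s' := by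
  generalize he : Expr.lam b = e at h
  obtain ⟨K, h⟩ := h
  cases K <;> simp only [ECtx.fill, reduceCtorEq] at he
  subst he
  exact h

theorem Step.emit_inv {v : Val} {e' : Exp} {s s' : State} {a : Option Val}
    (h : Step (.emit v) s a e' s') : Head (.emit v) s a e' s' := by
  generalize he : Expr.emit v = e at h
  obtain ⟨K, h⟩ := h
  cases K <;> simp only [ECtx.fill, reduceCtorEq] at he
  subst he
  exact h

theorem Step.app_values {u v : Val} {e' : Exp} {s s' : State} {a : Option Val}
    (h : Step (.app u.toExpr v.toExpr) s a e' s') : Head (.app u.toExpr v.toExpr) s a e' s' := by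
  rcases h.app_inv with h | ⟨x, h, -⟩ | ⟨_, x, -, h, -⟩
  exacts [h, (u.not_step h).elim, (v.not_step h).elim]

theorem Step.binop_values {o : Op} {u v : Val} {e' : Exp} {s s' : State} {a : Option Val}
    (h : Step (.binop o u.toExpr v.toExpr) s a e' s') :
    Head (.binop o u.toExpr v.toExpr) s a e' s' := by
  rcases h.binop_inv with h | ⟨x, h, -⟩ | ⟨_, x, -, h, -⟩
  exacts [h, (u.not_step h).elim, (v.not_step h).elim]

/-- Contexts compose: each frame of `K` is put outermost on the context found for the smaller step.
-/
theorem Step.fill (K : ECtx) {e e' : Exp} {s s' : State} {a : Option Val}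
    (h : Step e s a e' s') : Step (K.fill e) s a (K.fill e') s' := by
  induction K with
  | hole => exact h
  | appL K e ih =>
    obtain ⟨K', x, x', h₁, h₂, h⟩ := ih.exists_ctx
    simp only [ECtx.fill, h₁, h₂]
    exact .ctx (.appL K' e) h
  | appR v K ih =>
    obtain ⟨K', x, x', h₁, h₂, h⟩ := ih.exists_ctx
    simp only [ECtx.fill, h₁, h₂]
    exact .ctx (.appR v K') h
  | opL o K e ih =>
    obtain ⟨K', x, x', h₁, h₂, h⟩ := ih.exists_ctx
    simp only [ECtx.fill, h₁, h₂]
    exact .ctx (.opL o K' e) h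
  | opR o v K ih =>
    obtain ⟨K', x, x', h₁, h₂, h⟩ := ih.exists_ctx
    simp only [ECtx.fill, h₁, h₂]
    exact .ctx (.opR o v K') h
  | ite K e₁ e₂ ih =>
    obtain ⟨K', x, x', h₁, h₂, h⟩ := ih.exists_ctx
    simp only [ECtx.fill, h₁, h₂]
    exact .ctx (.ite K' e₁ e₂) h
  | pairL K e ih =>
    obtain ⟨K', x, x', h₁, h₂, h⟩ := ih.exists_ctx
    simp only [ECtx.fill, h₁, h₂]
    exact .ctx (.pairL K' e) h
  | pairR v K ih =>
    obtain ⟨K', x, x', h₁, h₂, h⟩ := ih.exists_ctx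
    simp only [ECtx.fill, h₁, h₂]
    exact .ctx (.pairR v K') h
  | fst K ih =>
    obtain ⟨K', x, x', h₁, h₂, h⟩ := ih.exists_ctx
    simp only [ECtx.fill, h₁, h₂]
    exact .ctx (.fst K') h
  | snd K ih =>
    obtain ⟨K', x, x', h₁, h₂, h⟩ := ih.exists_ctx
    simp only [ECtx.fill, h₁, h₂]
    exact .ctx (.snd K') h
  | ref K ih =>
    obtain ⟨K', x, x', h₁, h₂, h⟩ := ih.exists_ctx
    simp only [ECtx.fill, h₁, h₂]
    exact .ctx (.ref K') h
  | deref K ih =>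
    obtain ⟨K', x, x', h₁, h₂, h⟩ := ih.exists_ctx
    simp only [ECtx.fill, h₁, h₂]
    exact .ctx (.deref K') h

/-- `e` is a value. -/
def IsValue (e : Exp) : Prop := ∃ v : Val, e = v.toExpr

theorem isValue_toExpr (v : Val) : IsValue v.toExpr := ⟨v, rfl⟩

theorem isValue_int (z : ℤ) : IsValue (.int z) := ⟨.int z, rfl⟩

theorem isValue_loc (l : Loc) : IsValue (.loc l) := ⟨.loc l, rfl⟩

theorem isValue_fn (f : FunName) : IsValue (.fn f) := ⟨.fn f, rfl⟩

theorem IsValue.pair_inv {e₁ e₂ : Exp} (h : IsValue (.pair e₁ e₂)) : IsValue e₁ ∧ IsValue e₂ := by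
  obtain ⟨v, hv⟩ := h
  cases v <;> simp only [Value.toExpr, reduceCtorEq, Expr.pair.injEq] at hv
  exact ⟨⟨_, hv.1⟩, ⟨_, hv.2⟩⟩

theorem IsValue.pair {e₁ e₂ : Exp} (h₁ : IsValue e₁) (h₂ : IsValue e₂) :
    IsValue (.pair e₁ e₂) := by
  obtain ⟨u, rfl⟩ := h₁
  obtain ⟨v, rfl⟩ := h₂
  exact ⟨.pair u v, rfl⟩

/-- Only the pair frames can produce a value, and then both components are values. -/
theorem isValue_of_fill {K : ECtx} {e : Exp} (h : IsValue (K.fill e)) : IsValue e := by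
  induction K with
  | hole => exact h
  | pairL K _ ih => exact ih h.pair_inv.1
  | pairR _ K ih => exact ih h.pair_inv.2
  | _ =>
    obtain ⟨v, hv⟩ := h
    cases v <;> simp [ECtx.fill, Value.toExpr] at hv

/-- A step of a context filled with an expression that is not a value is a step of that
expression. -/
theorem Step.of_fill (K : ECtx) {e e' : Exp} {s s' : State} {a : Option Val} (he : ¬ IsValue e)
    (h : Step (K.fill e) s a e' s') : ∃ x, Step e s a x s' ∧ e' = K.fill x := by
  -- This excludes every step not taken inside the hole: a head reduction has values in the
  -- positions that evaluation frames occupy, and a step in a right operand requires a value on its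
  -- left.
  have hK : ∀ K : ECtx, ¬ IsValue (K.fill e) := fun K h => he (isValue_of_fill h)
  induction K generalizing e' with
  | hole => exact ⟨_, h, rfl⟩
  | appL K e₂ ih =>
    rcases Step.app_inv h with h | ⟨x, g, rfl⟩ | ⟨v, x, h, -, -⟩
    · generalize hx : K.fill e = x at h
      cases h
      exact (hK K (hx ▸ isValue_fn _)).elim
    · obtain ⟨y, hy, rfl⟩ := ih g
      exact ⟨y, hy, rfl⟩
    · exact (hK K ⟨v, h⟩).elim
  | appR v K ih =>
    rcases Step.app_inv h with h | ⟨x, g, rfl⟩ | ⟨v, x, -, g, rfl⟩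
    · generalize hx : K.fill e = x at h
      generalize v.toExpr = u at h
      cases h
      exact (hK K (hx ▸ isValue_toExpr _)).elim
    · exact (Value.not_step _ g).elim
    · obtain ⟨y, hy, rfl⟩ := ih g
      exact ⟨y, hy, rfl⟩
  | opL o K e₂ ih =>
    rcases Step.binop_inv h with h | ⟨x, g, rfl⟩ | ⟨v, x, h, -, -⟩
    · generalize hx : K.fill e = x at h
      refine (hK K (hx ▸ ?_)).elim
      cases h
      -- The rules are assignment, the two outcomes of the equality test, and arithmetic.
      exacts [isValue_loc _, isValue_toExpr _, isValue_toExpr _, isValue_int _]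
    · obtain ⟨y, hy, rfl⟩ := ih g
      exact ⟨y, hy, rfl⟩
    · exact (hK K ⟨v, h⟩).elim
  | opR o v K ih =>
    rcases Step.binop_inv h with h | ⟨x, g, rfl⟩ | ⟨v, x, -, g, rfl⟩
    · generalize hx : K.fill e = x at h
      generalize v.toExpr = u at h
      refine (hK K (hx ▸ ?_)).elim
      cases h
      exacts [isValue_toExpr _, isValue_toExpr _, isValue_toExpr _, isValue_int _]
    · exact (Value.not_step _ g).elim
    · obtain ⟨y, hy, rfl⟩ := ih g
      exact ⟨y, hy, rfl⟩
  | ite K e₁ e₂ ih =>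
    rcases Step.ite_inv h with h | ⟨x, g, rfl⟩
    · generalize hx : K.fill e = x at h
      refine (hK K (hx ▸ ?_)).elim
      cases h <;> exact isValue_int _
    · obtain ⟨y, hy, rfl⟩ := ih g
      exact ⟨y, hy, rfl⟩
  | pairL K e₂ ih =>
    rcases Step.pair_inv h with ⟨x, g, rfl⟩ | ⟨v, x, h, -, -⟩
    · obtain ⟨y, hy, rfl⟩ := ih g
      exact ⟨y, hy, rfl⟩
    · exact (hK K ⟨v, h⟩).elim
  | pairR v K ih =>
    rcases Step.pair_inv h with ⟨x, g, rfl⟩ | ⟨v, x, -, g, rfl⟩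
    · exact (Value.not_step _ g).elim
    · obtain ⟨y, hy, rfl⟩ := ih g
      exact ⟨y, hy, rfl⟩
  | fst K ih =>
    rcases Step.fst_inv h with h | ⟨x, g, rfl⟩
    · generalize hx : K.fill e = x at h
      refine (hK K (hx ▸ ?_)).elim
      cases h
      exact (isValue_toExpr _).pair (isValue_toExpr _)
    · obtain ⟨y, hy, rfl⟩ := ih g
      exact ⟨y, hy, rfl⟩
  | snd K ih =>
    rcases Step.snd_inv h with h | ⟨x, g, rfl⟩
    · generalize hx : K.fill e = x at h
      refine (hK K (hx ▸ ?_)).elim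
      cases h
      exact (isValue_toExpr _).pair (isValue_toExpr _)
    · obtain ⟨y, hy, rfl⟩ := ih g
      exact ⟨y, hy, rfl⟩
  | ref K ih =>
    rcases Step.ref_inv h with h | ⟨x, g, rfl⟩
    · generalize hx : K.fill e = x at h
      refine (hK K (hx ▸ ?_)).elim
      cases h
      exact isValue_toExpr _
    · obtain ⟨y, hy, rfl⟩ := ih g
      exact ⟨y, hy, rfl⟩
  | deref K ih =>
    rcases Step.deref_inv h with h | ⟨x, g, rfl⟩
    · generalize hx : K.fill e = x at h
      refine (hK K (hx ▸ ?_)).elim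
      cases h
      exact isValue_loc _
    · obtain ⟨y, hy, rfl⟩ := ih g
      exact ⟨y, hy, rfl⟩

/-! ## Resources -/

theorem TJoin.comm {a b c : TRes} (h : TJoin a b c) : TJoin b a c := by
  cases h
  exacts [.histR ‹_›, .histL ‹_›, .traceR ‹_›, .traceL ‹_›]

theorem Join.comm {a b c : Res} (h : Join a b c) : Join b a c := by
  obtain ⟨⟨d, e⟩, t⟩ := h
  exact ⟨⟨d.symm, by rw [e, Finmap.union_comm_of_disjoint d]⟩, t.comm⟩

theorem Join.assoc' {a b c bc abc : Res} (h₁ : Join b c bc) (h₂ : Join a bc abc) :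
    ∃ ab, Join a b ab ∧ Join ab c abc := by
  obtain ⟨x, hx, h⟩ := h₁.comm.assoc h₂.comm
  exact ⟨x, hx.comm, h.comm⟩

/-- Exclusivity: whoever else holds a compatible resource knows at most a prefix of `t`. -/
theorem TJoin.trace_left {t : Trace} {b c : TRes} (h : TJoin (.trace t) b c) :
    c = .trace t ∧ ∃ t', t' <+: t ∧ b = .hist t' := by
  cases h
  exact ⟨rfl, _, ‹_›, rfl⟩

/-- `t` is known to be a prefix of the current trace. -/
def TRes.HasPrefix (t : Trace) : TRes → Prop
  | .hist t' => t <+: t'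
  | .trace t' => t <+: t'

theorem TRes.hasPrefix_iff {t : Trace} {x : TRes} :
    x.HasPrefix t ↔ ∃ c, TJoin (.hist t) c x := by
  constructor
  · cases x
    · exact fun h => ⟨_, .histR h⟩
    · exact fun h => ⟨_, .traceR h⟩
  · rintro ⟨c, h⟩
    cases h
    exacts [List.prefix_rfl, ‹_›, ‹_›]

/-- Prefix knowledge is absorbed by a resource that already has it. This makes `hist` duplicable and
lets it be split off from `trace`. -/
theorem TRes.HasPrefix.join {t : Trace} {x : TRes} (h : x.HasPrefix t) : TJoin x (.hist t) x := by
  cases x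
  · exact .histL h
  · exact .traceL h

theorem Join.of_trace {m : Res} {t : Trace} (h : TJoin m.2 (.hist t) m.2) :
    Join m (∅, .hist t) m :=
  ⟨⟨fun _ _ hx => Finmap.notMem_empty hx, by simp⟩, h⟩

/-! ## The weakest precondition -/

theorem mem_wp {Q : Val → SemProp} {e : Exp} {w : World} {m : Res} :
    m ∈ wp Q e w ↔ m ∈ wpStep Q (wp Q) e w := by
  rw [wp, OrderHom.map_gfp]

/-- Coinduction for the weakest precondition. -/
theorem wp_coind {Q : Val → SemProp} {X : Exp → World → Set Res}
    (h : ∀ e w m, m ∈ X e w → m ∈ wpStep Q (X ⊔ wp Q) e w) {e : Exp} {w : World} {m : Res}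
    (hm : m ∈ X e w) : m ∈ wp Q e w := by
  -- Coinduction up to `wp`: a step may end in `X` or already in `wp Q`, since `wp Q` is itself a
  -- fixed point.
  have : X ⊔ wp Q ≤ wpStep Q (X ⊔ wp Q) := by
    refine sup_le (fun e w m => h e w m) ?_
    conv_lhs => rw [wp, ← OrderHom.map_gfp]
    exact (wpStep Q).monotone le_sup_right
  exact OrderHom.le_gfp _ this e w (.inl hm)

theorem wp_value {Q : Val → SemProp} {v : Val} {w : World} {m : Res} (h : m ∈ (Q v).sat w) :
    m ∈ wp Q v.toExpr w :=
  mem_wp.2 fun _ _ _ _ _ _ => ⟨fun _ => ⟨v, rfl, h⟩, fun _ _ _ hs => (v.not_step hs).elim⟩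

/-- Framing works because `wp` quantifies over all compatible resources of the surroundings, so `m₂`
can be counted among them. The change of postcondition is included, so that consequence and upward
closure become instances with a trivial `R`. -/
theorem wp_frame {Q Q' : Val → SemProp} {R : SemProp} {e : Exp} {w : World} {m₁ m₂ m : Res}
    (hQ : ∀ w', w ≤ w' → ∀ v m₁ m₂ m, m₁ ∈ (Q v).sat w' → m₂ ∈ R.sat w' → Join m₁ m₂ m →
      m ∈ (Q' v).sat w')
    (h₁ : m₁ ∈ wp Q e w) (h₂ : m₂ ∈ R.sat w) (hj : Join m₁ m₂ m) : m ∈ wp Q' e w := by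
  refine wp_coind (X := fun e w' => {m | w ≤ w' ∧ ∃ m₁ m₂, m₁ ∈ wp Q e w' ∧ m₂ ∈ R.sat w' ∧
    Join m₁ m₂ m}) ?_ ⟨le_rfl, m₁, m₂, h₁, h₂, hj⟩
  rintro e w' m ⟨hw, m₁, m₂, h₁, h₂, hj⟩ r mr t s hr hs
  -- `x` is `m₂` together with the outer frame `r`; relative to `m₁` it is the entire frame.
  obtain ⟨x, hx, hmx⟩ := hj.assoc hr
  obtain ⟨hv, hst⟩ := mem_wp.1 h₁ x mr t s hmx hs
  refine ⟨fun h => ?_, fun a e' s' h => ?_⟩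
  · obtain ⟨v, rfl, hm⟩ := hv h
    exact ⟨v, rfl, hQ w' hw v _ _ _ hm h₂ hj⟩
  · obtain ⟨w'', m', mr', h, hj', hs', hm'⟩ := hst a e' s' h
    -- After the step `m₂` is taken back from the frame; `R` still holds of it because assertions
    -- persist in later worlds.
    obtain ⟨y, hy, hyr⟩ := hx.assoc' hj'
    exact ⟨w'', y, mr', h, hyr, hs', .inl ⟨hw.trans h, m', m₂, hm', R.mono h h₂, hy⟩⟩

/-- An instance of framing with the unit resource. -/
theorem wp_mono {Q Q' : Val → SemProp} {e : Exp} {w : World} {m : Res}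
    (hQ : ∀ w', w ≤ w' → ∀ v, (Q v).sat w' ⊆ (Q' v).sat w') (h : m ∈ wp Q e w) :
    m ∈ wp Q' e w :=
  wp_frame (R := Kind.top .prop)
    (fun w' hw v _ m₂ _ h _ hj => hQ w' hw v ((Q v).upper h ⟨m₂, hj⟩)) h (Set.mem_univ _)
    (Join.one m)

theorem wp_upper {Q : Val → SemProp} {e : Exp} {w : World} {m m' : Res}
    (h : m ∈ wp Q e w) (hm : m.Le m') : m' ∈ wp Q e w := by
  obtain ⟨c, hc⟩ := hm
  exact wp_frame (R := Kind.top .prop) (fun w' _ v _ m₂ _ h _ hj => (Q v).upper h ⟨m₂, hj⟩) h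
    (Set.mem_univ _) hc

/-- As long as `e` reduces, every step of `K[e]` is a step of `e`; once `e` is stuck, its weakest
precondition makes it a value satisfying `Q`, and the assumption on `K` takes over. -/
theorem wp_bind {Q R : Val → SemProp} (K : ECtx) {e : Exp} {w : World} {m : Res}
    (hK : ∀ w', w ≤ w' → ∀ v, (Q v).sat w' ⊆ wp R (K.fill v.toExpr) w') (h : m ∈ wp Q e w) :
    m ∈ wp R (K.fill e) w := by
  refine wp_coind (X := fun e' w' => {m | w ≤ w' ∧ ∃ e, e' = K.fill e ∧ m ∈ wp Q e w'}) ?_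
    ⟨le_rfl, e, rfl, h⟩
  rintro _ w' m ⟨hw, e, rfl, h⟩ r mr t s hr hs
  obtain ⟨hv, hst⟩ := mem_wp.1 h r mr t s hr hs
  -- Splitting on stuckness, and not on being a value, is what gives access to `Q`: stuckness yields
  -- a value, and its negation excludes one.
  by_cases hstuck : Stuck e s
  · obtain ⟨v, rfl, hm⟩ := hv hstuck
    exact (wpStep R).monotone le_sup_right _ _ (mem_wp.1 (hK w' hw v hm)) r mr t s hr hs
  · have he : ¬ IsValue e := by
      rintro ⟨v, rfl⟩
      exact hstuck (v.stuck s)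
    refine ⟨fun hn => (hstuck fun a e' s' h => hn _ _ _ (h.fill K)).elim, fun a e' s' h => ?_⟩
    obtain ⟨x, hx, rfl⟩ := h.of_fill K he
    obtain ⟨w'', m', mr', h, hj', hs', hm'⟩ := hst a x s' hx
    exact ⟨w'', m', mr', h, hj', hs', .inl ⟨hw.trans h, x, rfl, hm'⟩⟩

/-- An expression that takes exactly one step, which is silent and does not change the state. -/
theorem wp_pure {Q : Val → SemProp} {e e₁ : Exp} {w : World} {m : Res}
    (hred : ∀ s : State, s.env = w.env → Step e s none e₁ s)
    (hdet : ∀ (s : State) a e' s', s.env = w.env → Step e s a e' s' → a = none ∧ e' = e₁ ∧ s' = s)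
    (h : m ∈ wp Q e₁ w) : m ∈ wp Q e w := by
  refine mem_wp.2 fun r mr t s hr hs => ⟨fun hn => (hn _ _ _ (hred s hs.2.2.1)).elim,
    fun a e' s' hstep => ?_⟩
  obtain ⟨rfl, rfl, rfl⟩ := hdet s a e' s' hs.2.2.1 hstep
  exact ⟨w, m, mr, le_rfl, hr, by simpa using hs, h⟩

/-! ### Weakest preconditions of silent redexes that leave the state unchanged. -/

theorem wp_fst {Q : Val → SemProp} {u v : Val} {w : World} {m : Res} (h : m ∈ (Q u).sat w) :
    m ∈ wp Q (.fst (.pair u.toExpr v.toExpr)) w := by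
  refine wp_pure (fun s _ => .head (.fst u v s)) (fun s a e' s' _ hs => ?_) (wp_value h)
  rcases hs.fst_inv with h | ⟨x, h, -⟩
  · generalize hu : u.toExpr = x, hv : v.toExpr = y at h
    cases h
    exact ⟨rfl, rfl, rfl⟩
  · exact ((Value.pair u v).not_step h).elim

theorem wp_snd {Q : Val → SemProp} {u v : Val} {w : World} {m : Res} (h : m ∈ (Q v).sat w) :
    m ∈ wp Q (.snd (.pair u.toExpr v.toExpr)) w := by
  refine wp_pure (fun s _ => .head (.snd u v s)) (fun s a e' s' _ hs => ?_) (wp_value h)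
  rcases hs.snd_inv with h | ⟨x, h, -⟩
  · generalize hu : u.toExpr = x, hv : v.toExpr = y at h
    cases h
    exact ⟨rfl, rfl, rfl⟩
  · exact ((Value.pair u v).not_step h).elim

theorem wp_itePos {Q : Val → SemProp} {z : ℤ} (hz : 0 < z) {e₁ e₂ : Exp} {w : World} {m : Res}
    (h : m ∈ wp Q e₁ w) : m ∈ wp Q (.ite (.int z) e₁ e₂) w := by
  refine wp_pure (fun s _ => .head (.itePos z e₁ e₂ s hz)) (fun s a e' s' _ hs => ?_) h
  rcases hs.ite_inv with h | ⟨x, h, -⟩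
  · cases h
    · exact ⟨rfl, rfl, rfl⟩
    · exact (lt_irrefl _ hz).elim
  · exact ((Value.int z).not_step h).elim

theorem wp_iteZero {Q : Val → SemProp} {e₁ e₂ : Exp} {w : World} {m : Res}
    (h : m ∈ wp Q e₂ w) : m ∈ wp Q (.ite (.int 0) e₁ e₂) w := by
  refine wp_pure (fun s _ => .head (.iteZero e₁ e₂ s)) (fun s a e' s' _ hs => ?_) h
  rcases hs.ite_inv with h | ⟨x, h, -⟩
  · cases h
    · exact (lt_irrefl _ ‹_›).elim
    · exact ⟨rfl, rfl, rfl⟩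
  · exact ((Value.int 0).not_step h).elim

theorem wp_arith {Q : Val → SemProp} {o : Arith} {a b : ℤ} {w : World} {m : Res}
    (h : m ∈ (Q (.int (o.eval a b))).sat w) : m ∈ wp Q (.binop (.arith o) (.int a) (.int b)) w := by
  refine wp_pure (fun s _ => .head (.arith o a b s)) (fun s _ e' s' _ hs => ?_) (wp_value h)
  cases Step.binop_values (u := .int a) (v := .int b) hs
  exact ⟨rfl, rfl, rfl⟩

theorem wp_eqTrue {Q : Val → SemProp} {v : Val} {w : World} {m : Res}
    (h : m ∈ (Q (.int 1)).sat w) : m ∈ wp Q (.binop .eq v.toExpr v.toExpr) w := by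
  refine wp_pure (fun s _ => .head (.eqTrue v s)) (fun s _ e' s' _ hs => ?_) (wp_value h)
  -- With the operands as separate expressions both equality rules can be inverted; the negative one
  -- contradicts injectivity of `Value.toExpr`.
  have key : ∀ (x y : Exp) (a : Option Val), x = y → Head (.binop .eq x y) s a e' s' →
      a = none ∧ e' = .int 1 ∧ s' = s := by
    intro x y a hxy h
    cases h
    · exact ⟨rfl, rfl, rfl⟩
    · exact (‹_ ≠ _› (Value.toExpr_injective hxy)).elim
  exact key _ _ _ rfl hs.binop_values

theorem wp_eqFalse {Q : Val → SemProp} {u v : Val} (huv : u ≠ v) {w : World} {m : Res}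
    (h : m ∈ (Q (.int 0)).sat w) : m ∈ wp Q (.binop .eq u.toExpr v.toExpr) w := by
  refine wp_pure (fun s _ => .head (.eqFalse u v s huv)) (fun s _ e' s' _ hs => ?_) (wp_value h)
  have hs := hs.binop_values
  generalize hu : u.toExpr = x, hv : v.toExpr = y at hs
  cases hs
  · exact (huv (Value.toExpr_injective (hu.trans hv.symm))).elim
  · exact ⟨rfl, rfl, rfl⟩

theorem wp_call {Q : Val → SemProp} {f : FunName} {v : Val} {b : Expr 1} {w : World} {m : Res}
    (hf : w.env.lookup f = some b) (h : m ∈ wp Q (b.inst v) w) :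
    m ∈ wp Q (.app (.fn f) v.toExpr) w := by
  refine wp_pure ?_ ?_ h
  · rintro ⟨h, γ⟩ hγ
    exact .head (.call f v b h γ ((congrArg (Finmap.lookup f) hγ).trans hf))
  · rintro ⟨h, γ⟩ a e' s' hγ hs
    have hs := Step.app_values (u := .fn f) hs
    simp only [Value.toExpr] at hs
    generalize hv : v.toExpr = x at hs
    cases hs
    rename_i b' hb
    obtain rfl : b' = b := Option.some.inj (hb.symm.trans ((congrArg (Finmap.lookup f) hγ).trans hf))
    rw [Value.toExpr_injective hv]
    exact ⟨rfl, rfl, rfl⟩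

/-! ### Weakest preconditions of redexes that extend the state, access the heap or emit an event. -/

theorem Finmap.exists_notMem {α : Type} (h : Finmap (fun _ : ℕ => α)) : ∃ l, l ∉ h := by
  obtain ⟨l, hl⟩ := Infinite.exists_notMem_finset h.keys
  exact ⟨l, fun h => hl (Finmap.mem_keys.2 h)⟩

/-- Reduction picks the name, so the postcondition is required for every name and every later world
that binds it to `b`. The extended environment is a later world because a fresh name overwrites no
binding. -/
theorem wp_lam {Q : Val → SemProp} {b : Expr 1} {w : World} {m : Res}
    (h : ∀ (f : FunName) (w' : World), w ≤ w' → w'.env.lookup f = some b →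
      m ∈ (Q (.fn f)).sat w') : m ∈ wp Q (.lam b) w := by
  refine mem_wp.2 fun r mr t s hr hs => ⟨fun hn => ?_, fun a e' s' hstep => ?_⟩
  · obtain ⟨hp, γ⟩ := s
    obtain ⟨f, hf⟩ := Finmap.exists_notMem γ
    exact (hn _ _ _ (.head (.lam b hp γ f hf))).elim
  · have hh := hstep.lam_inv
    cases hh with
    | lam _ hp γ f hf =>
      obtain ⟨ht, hheap, henv, hinv⟩ := hs
      have hlt : w ≤ ⟨w.env.insert f b, w.inv⟩ := by
        refine ⟨fun g c hg => ?_, rfl⟩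
        change Finmap.lookup g (w.env.insert f b) = some c
        rw [Finmap.lookup_insert_of_ne, hg]
        rintro rfl
        exact hf (Finmap.mem_iff.2 ⟨c, (congrArg _ henv).trans hg⟩)
      refine ⟨⟨w.env.insert f b, w.inv⟩, m, mr, hlt, hr, ⟨?_, hheap, ?_, ?_⟩,
        wp_value (v := .fn f) (h f _ hlt (Finmap.lookup_insert _))⟩
      · simpa using ht
      · exact congrArg (Finmap.insert f b) henv
      · simpa using hinv

/-- A change of the heap outside the frame preserves the frame. Allocation obtains `l ∉ r.1` from
freshness, assignment from disjointness. -/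
theorem Join.insert {m r mr : Res} (h : Join m r mr) {l : Loc} (hl : l ∉ r.1) (v : Val) :
    Join (m.1.insert l v, m.2) r (mr.1.insert l v, mr.2) := by
  obtain ⟨⟨hd, he⟩, ht⟩ := h
  refine ⟨⟨fun x hx hr => ?_, ?_⟩, ht⟩
  · rcases Finmap.mem_insert.1 hx with rfl | hx
    · exact hl hr
    · exact hd x hx hr
  · simp only [he, Finmap.insert_union]

theorem wp_alloc {Q : Val → SemProp} {v : Val} {w : World} {m : Res}
    (h : ∀ l, l ∉ m.1 → (m.1.insert l v, m.2) ∈ (Q (.loc l)).sat w) :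
    m ∈ wp Q (.ref v.toExpr) w := by
  refine mem_wp.2 fun r mr t s hr hs => ⟨fun hn => ?_, fun a e' s' hstep => ?_⟩
  · obtain ⟨hp, γ⟩ := s
    obtain ⟨l, hl⟩ := Finmap.exists_notMem hp
    exact (hn _ _ _ (.head (.ref v l hp γ hl))).elim
  · rcases hstep.ref_inv with hh | ⟨x, hh, -⟩
    · generalize hv : v.toExpr = x at hh
      cases hh with
      | ref u l hp γ hl =>
        obtain rfl := Value.toExpr_injective hv
        obtain ⟨ht, hheap, henv, hinv⟩ := hs
        simp only at hheap henv
        rw [hheap, hr.1.2, Finmap.mem_union, not_or] at hl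
        refine ⟨w, (m.1.insert l v, m.2), _, le_rfl, hr.insert hl.2 v, ⟨?_, ?_, henv, ?_⟩,
          wp_value (v := .loc l) (h l hl.1)⟩
        · simpa using ht
        · simp only [hheap]
        · simpa using hinv
    · exact (v.not_step hh).elim

theorem Join.lookup {m r mr : Res} (h : Join m r mr) {l : Loc} {v : Val}
    (hl : m.1.lookup l = some v) : mr.1.lookup l = some v := by
  have hm : l ∈ m.1 := Finmap.mem_iff.2 ⟨v, hl⟩
  rw [h.1.2, Finmap.lookup_union_left hm, hl]

theorem wp_read {Q : Val → SemProp} {l : Loc} {v : Val} {w : World} {m : Res}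
    (hl : m.1.lookup l = some v) (h : m ∈ (Q v).sat w) : m ∈ wp Q (.deref (.loc l)) w := by
  refine mem_wp.2 fun r mr t s hr hs => ⟨fun hn => ?_, fun a e' s' hstep => ?_⟩
  · obtain ⟨hp, γ⟩ := s
    obtain rfl : hp = mr.1 := hs.2.1
    exact (hn _ _ _ (.head (.deref l v _ γ (hr.lookup hl)))).elim
  · rcases hstep.deref_inv with hh | ⟨x, hh, -⟩
    · cases hh with
      | deref _ u hp γ hu =>
        obtain rfl : hp = mr.1 := hs.2.1
        obtain rfl : u = v := Option.some.inj (hu.symm.trans (hr.lookup hl))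
        exact ⟨w, m, mr, le_rfl, hr, by simpa using hs, wp_value h⟩
    · exact ((Value.loc l).not_step hh).elim

theorem wp_write {Q : Val → SemProp} {l : Loc} {u v : Val} {w : World} {m : Res}
    (hl : m.1.lookup l = some u) (h : (m.1.insert l v, m.2) ∈ (Q .unit).sat w) :
    m ∈ wp Q (.binop .assign (.loc l) v.toExpr) w := by
  refine mem_wp.2 fun r mr t s hr hs => ⟨fun hn => ?_, fun a e' s' hstep => ?_⟩
  · obtain ⟨hp, γ⟩ := s
    obtain rfl : hp = mr.1 := hs.2.1
    exact (hn _ _ _ (.head (.assign l v _ γ (Finmap.mem_iff.2 ⟨u, hr.lookup hl⟩)))).elim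
  · have hh := Step.binop_values (u := .loc l) hstep
    simp only [Value.toExpr] at hh
    generalize hv : v.toExpr = x at hh
    cases hh with
    | assign _ u hp γ hu =>
      obtain rfl := Value.toExpr_injective hv
      obtain ⟨ht, hheap, henv, hinv⟩ := hs
      simp only at hheap henv
      refine ⟨w, (m.1.insert l v, m.2), _, le_rfl,
        hr.insert (hr.1.1 l (Finmap.mem_iff.2 ⟨_, hl⟩)) v, ⟨?_, ?_, henv, ?_⟩,
        wp_value (v := .unit) h⟩
      · simpa using ht
      · simp only [hheap]
      · simpa using hinv

/-- Ownership of `trace t` forces the actual trace to be `t`, so `hinv` concerns precisely the next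
trace. The frame survives the event: it knows only a prefix of `t`, which is still a prefix of `t ++
[v]`. -/
theorem wp_emit {Q : Val → SemProp} {v : Val} {t : Trace} {w : World} {m : Res}
    (ht : m.2 = .trace t) (hinv : t ++ [v] ∈ w.inv)
    (h : (m.1, .trace (t ++ [v])) ∈ (Q .unit).sat w) : m ∈ wp Q (.emit v) w := by
  obtain ⟨hp, τ⟩ := m
  obtain rfl : τ = .trace t := ht
  refine mem_wp.2 fun r mr t' s hr hs => ⟨fun hn => ?_, fun a e' s' hstep => ?_⟩
  · exact (hn _ _ _ (.head (.emit v s))).elim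
  · have hh := hstep.emit_inv
    cases hh
    obtain ⟨hmr, t'', hpre, hr2⟩ := hr.2.trace_left
    obtain ⟨ht', hheap, henv, -⟩ := hs
    rw [hmr] at ht'
    obtain rfl : t' = t := ht'
    refine ⟨w, (hp, .trace (t' ++ [v])), (mr.1, .trace (t' ++ [v])), le_rfl, ⟨hr.1, ?_⟩,
      ⟨rfl, hheap, henv, hinv⟩, wp_value (v := .unit) h⟩
    rw [hr2]
    exact .traceL (hpre.trans (List.prefix_append _ _))

/-- Each step is taken with the unit resource as frame. The new configuration realizes a resource
`mr'` above `m'`, so `wp` is carried over to `mr'` by upward closure; the invariant is the same in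
all worlds visited, and realization contains membership in it. -/
theorem wp_adequate {Q : Val → SemProp} {e e' : Exp} {s s' : State} {w : World} {m : Res}
    {t t' : Trace} (h : Steps e s t' e' s') (hm : m ∈ wp Q e w) (hr : Realizes t s w m) :
    t ++ t' ∈ w.inv := by
  induction h generalizing t w m with
  | refl e s => simpa using hr.2.2.2
  | step hs _ ih =>
    obtain ⟨w', m', mr', hw, hj, hr', hm'⟩ :=
      (mem_wp.1 hm Res.one m t _ (Join.one m) hr).2 _ _ _ hs
    rw [← List.append_assoc, hw.2]
    exact ih (wp_upper hm' ⟨_, hj⟩) hr'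

/-! ## Interpretation of renaming and substitution -/

theorem Env.cons_comp_up {Γ Δ : TCtx} {σ : Ty} (r : Ren Γ Δ) (a : σ.denote) (ρ : Env Δ) :
    (fun τ x => ρ.cons a τ (r.up τ x)) = Env.cons (Γ := Γ) a (fun τ x => ρ τ (r τ x)) := by
  funext τ x
  cases x <;> rfl

theorem Tm.denote_rename {Γ : TCtx} {c : Cls} (M : Tm Γ c) {Δ : TCtx} (r : Ren Γ Δ) (ρ : Env Δ) :
    (M.rename r).denote ρ = M.denote (fun τ x => ρ τ (r τ x)) := by
  induction M generalizing Δ <;> simp only [Tm.rename, Tm.denote, Env.cons_comp_up, *]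

theorem Tm.denote_wk {Γ : TCtx} {c : Cls} {σ : Ty} (M : Tm Γ c) (a : σ.denote) (ρ : Env Γ) :
    M.wk.denote (ρ.cons a) = M.denote ρ := M.denote_rename _ _

theorem Tm.denote_wk' {Γ : TCtx} {c : Cls} {σ τ : Ty} (M : Tm (τ :: Γ) c) (a : σ.denote)
    (b : τ.denote) (ρ : Env Γ) :
    M.wk'.denote (Env.cons b (Env.cons a ρ)) = M.denote (Env.cons b ρ) := by
  rw [Tm.wk', Tm.denote_rename, Env.cons_comp_up]
  rfl

theorem Env.cons_subst_up {Γ Δ : TCtx} {σ : Ty} (s : Sub Γ Δ) (a : σ.denote) (ρ : Env Δ) :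
    (fun τ x => (s.up τ x).denote (ρ.cons a)) =
      Env.cons (Γ := Γ) a (fun τ x => (s τ x).denote ρ) := by
  funext τ x
  cases x
  · rfl
  · exact Tm.denote_wk _ _ _

theorem Tm.denote_subst {Γ : TCtx} {c : Cls} (M : Tm Γ c) {Δ : TCtx} (s : Sub Γ Δ) (ρ : Env Δ) :
    (M.subst s).denote ρ = M.denote (fun τ x => (s τ x).denote ρ) := by
  induction M generalizing Δ <;> simp only [Tm.subst, Tm.denote, Env.cons_subst_up, *]

theorem Tm.denote_inst {Γ : TCtx} {c : Cls} {σ : Ty} (M : Tm (σ :: Γ) c) (N : Term Γ σ)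
    (ρ : Env Γ) : (M.inst N).denote ρ = M.denote (ρ.cons (N.denote ρ)) := by
  rw [Tm.inst, Tm.denote_subst]
  congr 1
  funext τ x
  cases x <;> rfl

/-! ## Interpretation of program substitution and flattening -/

/-- Substitution of closed values for the program variables of the interpretation of a term. -/
def Cls.psubst : (c : Cls) → c.denote → {m : ℕ} → PSub Val c.depth m → (c.setDepth m).denote
  | .ty _, a, _, _ => a
  | .pval _, v, _, σ => v.subst σ
  | .pexp _, e, _, σ => e.subst σ

/-- The pointwise interpretation of a substitution for program variables. -/
noncomputable def PSub.denote {Γ : TCtx} {n m : ℕ} (σ : PSub (Term Γ .val) n m) (ρ : Env Γ) :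
    PSub Val n m := fun i => (σ i).map id (fun v => v.denote ρ)

theorem PSub.denote_up {Γ : TCtx} {n m : ℕ} (σ : PSub (Term Γ .val) n m) (ρ : Env Γ) :
    PSub.denote σ.up ρ = (PSub.denote σ ρ).up := by
  funext i
  refine Fin.cases rfl (fun i => ?_) i
  simp only [PSub.denote, PSub.up, Fin.cases_succ]
  cases σ i <;> rfl

theorem PSub.empty_comp {n m : ℕ} (σ : PSub Val n m) : PSub.empty.comp σ = PSub.empty :=
  funext fun i => i.elim0

/-- The cases with content are variables, binders and quoted logical terms; the latter denote closed
programs, which substitution for program variables leaves alone on both sides. -/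
theorem Tm.denote_psubst {Γ : TCtx} {c : Cls} (M : Tm Γ c) {m : ℕ}
    (σ : PSub (Term Γ .val) c.depth m) (ρ : Env Γ) :
    (M.psubst σ).denote ρ = c.psubst (M.denote ρ) (PSub.denote σ ρ) := by
  induction M generalizing m with
  | pvar i =>
    simp only [Tm.psubst, Tm.denote, Cls.psubst, Value.subst, PSub.denote]
    cases σ i <;> rfl
  | pterm M => simp only [Tm.psubst, Tm.denote, Cls.psubst, Value.subst_wk]
  | evalue v ih =>
    simp only [Tm.psubst, Tm.denote, Cls.psubst, Value.toExpr_subst]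
    exact congrArg Value.toExpr (ih _ _)
  | elam e ih =>
    simp only [Tm.psubst, Tm.denote, Cls.psubst, Expr.subst, ← PSub.denote_up]
    exact congrArg Expr.lam (ih _ _)
  | eterm M =>
    simp only [Tm.psubst, Tm.denote, Cls.psubst, Expr.subst_subst, PSub.empty_comp]
  | ppair u v hu hv => exact congrArg₂ Value.pair (hu σ ρ) (hv σ ρ)
  | eapp e e' h h' => exact congrArg₂ Expr.app (h σ ρ) (h' σ ρ)
  | eite e e₁ e₂ h h₁ h₂ =>
    exact congr (congrArg₂ Expr.ite (h σ ρ) (h₁ σ ρ)) (h₂ σ ρ)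
  | epair e e' h h' => exact congrArg₂ Expr.pair (h σ ρ) (h' σ ρ)
  | efst e h => exact congrArg Expr.fst (h σ ρ)
  | esnd e h => exact congrArg Expr.snd (h σ ρ)
  | eref e h => exact congrArg Expr.ref (h σ ρ)
  | ederef e h => exact congrArg Expr.deref (h σ ρ)
  | ebinop o e e' h h' => exact congrArg₂ (Expr.binop o) (h σ ρ) (h' σ ρ)
  | eemit v h => exact congrArg Expr.emit (h σ ρ)
  | _ => rfl

/-- Values as expressions; the identity on expressions. -/
def Cls.expand : (c : Cls) → c.denote → Expr c.depth
  | .ty _, _ => .unit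
  | .pval _, v => v.toExpr
  | .pexp _, e => e

theorem Tm.denote_expand {Γ : TCtx} {c : Cls} (M : Tm Γ c) (ρ : Env Γ) :
    M.expand.denote ρ = c.expand (M.denote ρ) := by
  induction M with
  | ppair u v hu hv =>
    simp only [Tm.expand, Tm.denote, Cls.expand, Value.toExpr]
    exact congrArg₂ Expr.pair (hu ρ) (hv ρ)
  | _ => rfl

/-- Removing a quotation replaces semantic weakening of a closed program by the syntactic
substitution with empty domain; these agree by `Tm.denote_psubst`. This validates the `flatten`
conversion. -/
theorem Tm.denote_flatten {Γ : TCtx} {c : Cls} (M : Tm Γ c) (ρ : Env Γ) :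
    M.flatten.denote ρ = M.denote ρ := by
  induction M with
  | pterm M ih =>
    rw [Tm.flatten]
    split
    · rename_i v hv
      rw [Tm.denote, ← ih ρ, hv]
      refine (Tm.denote_psubst v _ ρ).trans ?_
      rw [show PSub.denote PSub.empty ρ = PSub.empty from funext fun i => i.elim0]
      exact Value.subst_empty _
    · rw [Tm.denote, ih ρ, Tm.denote]
  | eterm M ih =>
    rw [Tm.flatten]
    split
    · rename_i e he
      rw [Tm.denote, ← ih ρ, he]
      refine (Tm.denote_psubst e _ ρ).trans ?_
      rw [show PSub.denote PSub.empty ρ = PSub.empty from funext fun i => i.elim0]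
      rfl
    · rw [Tm.denote, ih ρ, Tm.denote]
  | evalue v ih =>
    rw [Tm.flatten, Tm.denote]
    refine (Tm.denote_expand _ ρ).trans ?_
    rw [ih ρ]
    rfl
  | ofPVal | ofPExp | ppair | elam | eapp | eite | epair | efst | esnd | eref | ederef | ebinop
  | eemit => simp only [Tm.flatten, Tm.denote, *]
  -- `Tm.flatten` distinguishes the types `val` and `exp` first, so a constructor with arbitrary
  -- result type computes only once that type is known.
  | @var _ τ => cases τ <;> rfl
  | @app _ _ τ => cases τ <;> rfl
  | @fst _ σ => cases σ <;> rfl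
  | @snd _ _ τ => cases τ <;> rfl
  | @ite _ τ => cases τ <;> rfl
  | @natrec _ σ => cases σ <;> rfl
  | @fold _ σ => cases σ <;> rfl
  | _ => rfl

/-! ## Semantic facts about the connectives -/

namespace SemProp

/-- For conjuncts such as equalities and `inv`, which consume nothing and therefore hold of the
unit. -/
theorem mem_star_of_left {P Q : SemProp} {w : World} {m : Res} (hm : m ∈ P.sat w)
    (h : Res.one ∈ Q.sat w) : m ∈ (star P Q).sat w :=
  ⟨m, Res.one, hm, h, Join.one m⟩

theorem mem_star_of_right {P Q : SemProp} {w : World} {m : Res} (hm : m ∈ Q.sat w)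
    (h : Res.one ∈ P.sat w) : m ∈ (star P Q).sat w :=
  ⟨Res.one, m, h, hm, (Join.one m).comm⟩

/-- `trace t` is maximal among trace resources, so the upward closure in the definition adds
nothing. -/
theorem mem_trace {t : Trace} {w : World} {m : Res} :
    m ∈ (tracing (.trace t)).sat w ↔ m.2 = .trace t := by
  constructor
  · rintro ⟨c, hc⟩
    exact hc.trace_left.1
  · intro h
    exact ⟨.hist [], h ▸ .traceL List.nil_prefix⟩

theorem mem_hist {t : Trace} {w : World} {m : Res} :
    m ∈ (tracing (.hist t)).sat w ↔ m.2.HasPrefix t := TRes.hasPrefix_iff.symm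

theorem star_comm {P Q : SemProp} {w : World} : (star P Q).sat w ⊆ (star Q P).sat w := by
  rintro m ⟨m₁, m₂, h₁, h₂, hj⟩
  exact ⟨m₂, m₁, h₂, h₁, hj.comm⟩

theorem star_assoc {P Q R : SemProp} {w : World} :
    (star (star P Q) R).sat w ⊆ (star P (star Q R)).sat w := by
  rintro m ⟨_, m₃, ⟨m₁, m₂, h₁, h₂, hj⟩, h₃, hj'⟩
  obtain ⟨x, hx, h⟩ := hj.assoc hj'
  exact ⟨m₁, x, h₁, ⟨m₂, m₃, h₂, h₃, hx⟩, h⟩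

theorem star_left {P Q : SemProp} {w : World} : (star P Q).sat w ⊆ P.sat w := by
  rintro m ⟨m₁, m₂, h₁, -, hj⟩
  exact P.upper h₁ ⟨m₂, hj⟩

theorem star_right {P Q : SemProp} {w : World} : (star P Q).sat w ⊆ Q.sat w :=
  star_comm.trans star_left

theorem pointsTo_excl {l : Loc} {u v : Val} {w : World} {m : Res} :
    m ∉ (star (pointsTo l u) (pointsTo l v)).sat w := by
  rintro ⟨m₁, m₂, h₁, h₂, hj⟩
  have h₁ : m₁.1.lookup l = some u := h₁
  have h₂ : m₂.1.lookup l = some v := h₂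
  exact hj.1.1 l (Finmap.mem_iff.2 ⟨_, h₁⟩) (Finmap.mem_iff.2 ⟨_, h₂⟩)

theorem trace_excl {t t' : Trace} {w : World} {m : Res} :
    m ∉ (star (tracing (.trace t)) (tracing (.trace t'))).sat w := by
  rintro ⟨m₁, m₂, h₁, h₂, hj⟩
  rw [mem_trace] at h₁ h₂
  have := hj.2
  rw [h₁, h₂] at this
  cases this

theorem hist_dupl {t : Trace} {w : World} :
    (tracing (.hist t)).sat w ⊆ (star (tracing (.hist t)) (tracing (.hist t))).sat w :=
  fun m hm => ⟨m, (∅, .hist t), hm, mem_hist.2 List.prefix_rfl, .of_trace (mem_hist.1 hm).join⟩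

theorem trace_hist {t : Trace} {w : World} :
    (tracing (.trace t)).sat w ⊆ (star (tracing (.trace t)) (tracing (.hist t))).sat w := by
  intro m hm
  refine ⟨m, (∅, .hist t), hm, mem_hist.2 List.prefix_rfl, .of_trace (TRes.HasPrefix.join ?_)⟩
  rw [mem_trace.1 hm]
  exact List.prefix_rfl

/-- The `hist` part may know a longer history than `t₂`, but the composition with `trace t₁` exists
only if that history is a prefix of `t₁`. -/
theorem prefix_of_trace_hist {t₁ t₂ : Trace} {w : World} {m : Res}
    (h : m ∈ (star (tracing (.trace t₁)) (tracing (.hist t₂))).sat w) : t₂ <+: t₁ := by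
  obtain ⟨m₁, m₂, h₁, h₂, hj⟩ := h
  have hj := hj.2
  rw [mem_trace.1 h₁] at hj
  obtain ⟨-, t', ht', he⟩ := hj.trace_left
  have h₂ := mem_hist.1 h₂
  rw [he] at h₂
  exact h₂.trans ht'

end SemProp

/-! ## Interpretation of the derived forms -/

section Derived

variable {Γ : TCtx}

theorem Tm.denote_valE (v : Term Γ .val) (ρ : Env Γ) :
    (Tm.valE (n := 0) v).denote ρ = (v.denote ρ).toExpr :=
  congrArg Value.toExpr (Value.wk_zero _)

theorem Tm.denote_eterm (e : Term Γ .exp) (ρ : Env Γ) :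
    (Tm.eterm (n := 0) e).denote ρ = e.denote ρ := Expr.subst_closed _ _

/-- Connects the premise of the abstraction rule, whose argument is a fresh logical variable, with
the instance of the body that a call reduces to. -/
theorem Tm.denote_psubst_one (e : Tm Γ (.pexp 1)) (v : Val) (ρ : Env Γ) :
    Tm.denote (Tm.psubst (m := 0) (e.wk (σ := .val)) (PSub.one (.var .zero)))
      (Env.cons (σ := .val) v ρ) = (e.denote ρ).inst v := by
  refine (Tm.denote_psubst _ _ _).trans ?_
  rw [Tm.denote_wk]
  rfl

theorem Tm.denote_append {τ : Ty} (M N : Term Γ (.seq τ)) (ρ : Env Γ) :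
    (M.append N).denote ρ = List.append (M.denote ρ) (N.denote ρ) := by
  change List.foldr (fun x a => List.cons x a) (N.denote ρ) (M.denote ρ) = _
  generalize (M.denote ρ : List τ.denote) = l
  induction l with
  | nil => rfl
  | cons a l ih => exact congrArg (List.cons a) ih

theorem Tm.denote_snoc {τ : Ty} (t : Term Γ (.seq τ)) (v : Term Γ τ) (ρ : Env Γ) :
    (t.snoc v).denote ρ = List.append (t.denote ρ) [v.denote ρ] := Tm.denote_append _ _ _

theorem Tm.denote_isPrefix {τ : Ty} {M N : Term Γ (.seq τ)} {ρ : Env Γ}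
    (h : (M.denote ρ : List τ.denote) <+: N.denote ρ) (w : World) (m : Res) :
    m ∈ SemProp.sat ((M.isPrefix N).denote ρ) w := by
  obtain ⟨l, hl⟩ := h
  refine ⟨l, ?_⟩
  change (Tm.append M.wk (.var .zero)).denote (Env.cons (σ := .seq τ) l ρ) = N.wk.denote (Env.cons (σ := .seq τ) l ρ)
  rw [Tm.denote_append, Tm.denote_wk, Tm.denote_wk]
  exact hl

theorem Tm.denote_iff_spec (S T : Term Γ .spec) (ρ : Env Γ) (w : World) :
    SemSpec.holds ((Tm.iff S T).denote ρ) w ↔ ∀ w', w ≤ w' →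
      (SemSpec.holds (S.denote ρ) w' ↔ SemSpec.holds (T.denote ρ) w') :=
  ⟨fun h w' hw => ⟨h.1 w' hw, h.2 w' hw⟩,
    fun h => ⟨fun w' hw => (h w' hw).1, fun w' hw => (h w' hw).2⟩⟩

/-- The interpretation of evaluation contexts. -/
noncomputable def KCtx.denote : KCtx Γ → Env Γ → ECtx
  | .hole, _ => .hole
  | .appL K e, ρ => .appL (K.denote ρ) (e.denote ρ)
  | .appR v K, ρ => .appR (v.denote ρ) (K.denote ρ)
  | .opL o K e, ρ => .opL o (K.denote ρ) (e.denote ρ)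
  | .opR o v K, ρ => .opR o (v.denote ρ) (K.denote ρ)
  | .ite K e₁ e₂, ρ => .ite (K.denote ρ) (e₁.denote ρ) (e₂.denote ρ)
  | .pairL K e, ρ => .pairL (K.denote ρ) (e.denote ρ)
  | .pairR v K, ρ => .pairR (v.denote ρ) (K.denote ρ)
  | .fst K, ρ => .fst (K.denote ρ)
  | .snd K, ρ => .snd (K.denote ρ)
  | .ref K, ρ => .ref (K.denote ρ)
  | .deref K, ρ => .deref (K.denote ρ)

theorem KCtx.denote_fill (K : KCtx Γ) (e : Term Γ .exp) (ρ : Env Γ) :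
    (K.fill e).denote ρ = (K.denote ρ).fill (e.denote ρ) := by
  induction K with
  | hole => exact Tm.denote_eterm e ρ
  | _ => simp only [KCtx.fill, KCtx.denote, ECtx.fill, Tm.denote, Expr.subst_closed,
      Value.wk_zero, *]

theorem KCtx.denote_wk (K : KCtx Γ) {σ : Ty} (a : σ.denote) (ρ : Env Γ) :
    (K.wk).denote (ρ.cons a) = K.denote ρ := by
  induction K with
  | hole => rfl
  | _ => simp only [KCtx.wk, KCtx.denote, Tm.denote_wk, *]

/-- The outermost form of a closed value. -/
def Value.tag : Val → VTag
  | .unit => .unit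
  | .int z => .int z
  | .var i => i.elim0
  | .loc _ => .loc
  | .fn f => .fn f
  | .pair _ _ => .pair

theorem Tm.tag_denote {u : Tm Γ (.pval 0)} {a : VTag} (h : u.vtag = some a) (ρ : Env Γ) :
    Value.tag (u.denote ρ) = a := by
  cases u <;> simp only [Tm.vtag, reduceCtorEq, Option.some.injEq] at h <;> exact h

/-- Beta is the substitution lemma, eta is weakening, and the quotation rules are triviality of
substitution in closed programs; the remaining rules are computations of the model. -/
theorem Conv.denote_eq {τ : Ty} {M N : Term Γ τ} (h : Conv M N) (ρ : Env Γ) :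
    M.denote ρ = N.denote ρ := by
  cases h with
  | beta M N => exact (Tm.denote_inst M N ρ).symm
  | eta M =>
    funext a
    exact congrFun (Tm.denote_wk M a ρ).symm a
  | ofPVal v => exact Value.wk_zero _
  | ofPExp e => exact Expr.subst_closed _ _
  | flatten M => exact (Tm.denote_flatten M ρ).symm
  | _ => rfl

end Derived

/-! ## Soundness of the proof system -/

/-- The specifications in `Θ` hold in the world `w`. -/
def HypSat {Γ : TCtx} (Θ : List (Term Γ .spec)) (ρ : Env Γ) (w : World) : Prop :=
  ∀ S ∈ Θ, SemSpec.holds (S.denote ρ) w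

/-- A judgement is true in the world `w`. -/
def Judg.Sat {Γ : TCtx} : Judg Γ → Env Γ → World → Prop
  | .spec S, ρ, w => SemSpec.holds (S.denote ρ) w
  | .ent P Q, ρ, w => SemProp.sat (P.denote ρ) w ⊆ SemProp.sat (Q.denote ρ) w

section Sat

variable {Γ : TCtx} {Θ : List (Term Γ .spec)} {ρ : Env Γ} {w w' : World}

theorem HypSat.mono (h : w ≤ w') (hΘ : HypSat Θ ρ w) : HypSat Θ ρ w' :=
  fun S hS => SemSpec.mono (S.denote ρ) h (hΘ S hS)

theorem HypSat.cons {S : Term Γ .spec} (hS : SemSpec.holds (S.denote ρ) w)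
    (hΘ : HypSat Θ ρ w) : HypSat (S :: Θ) ρ w :=
  List.forall_mem_cons.2 ⟨hS, hΘ⟩

theorem HypSat.wk {σ : Ty} (hΘ : HypSat Θ ρ w) (a : σ.denote) :
    HypSat (wkCtx Θ) (ρ.cons a) w := by
  intro S hS
  obtain ⟨T, hT, rfl⟩ := List.mem_map.1 hS
  rw [Tm.denote_wk]
  exact hΘ T hT

theorem Judg.sat_wk {J : Judg Γ} {σ : Ty} (a : σ.denote) : J.wk.Sat (ρ.cons a) w ↔ J.Sat ρ w := by
  cases J <;> simp only [Judg.wk, Judg.Sat, Tm.denote_wk]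

theorem Judg.sat_inst {τ : Ty} (S : Term (τ :: Γ) .spec) (N : Term Γ τ) :
    (Judg.spec (S.inst N)).Sat ρ w ↔ (Judg.spec S).Sat (ρ.cons (N.denote ρ)) w := by
  simp only [Judg.Sat, Tm.denote_inst]

end Sat

/-- Induction on the derivation, with the world varying because implications, wands and triples
quantify over later worlds; `HypSat.mono` transports the hypotheses there. Changes of variable
context are handled by the weakening and substitution lemmas for interpretations. -/
theorem Deriv.sound {Γ : TCtx} {Θ : List (Term Γ .spec)} {J : Judg Γ} (h : Deriv Θ J)
    (ρ : Env Γ) (w : World) (hΘ : HypSat Θ ρ w) : J.Sat ρ w := by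
  induction h generalizing w with
  | hyp h => exact hΘ _ h
  | cut _ _ ih₁ ih₂ => exact ih₂ ρ w (hΘ.cons (ih₁ ρ w hΘ))
  | weaken hs _ ih => exact ih ρ w fun S hS => hΘ S (hs hS)
  | topI => trivial
  | botE _ ih => exact (ih ρ w hΘ).elim
  | andI _ _ ih₁ ih₂ => exact ⟨ih₁ ρ w hΘ, ih₂ ρ w hΘ⟩
  | andE₁ _ ih => exact (ih ρ w hΘ).1
  | andE₂ _ ih => exact (ih ρ w hΘ).2
  | orI₁ _ ih => exact Or.inl (ih ρ w hΘ)
  | orI₂ _ ih => exact Or.inr (ih ρ w hΘ)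
  | orE _ _ _ ih ih₁ ih₂ =>
    rcases ih ρ w hΘ with h | h
    · exact ih₁ ρ w (hΘ.cons h)
    · exact ih₂ ρ w (hΘ.cons h)
  | impI _ ih => exact fun w' hw hS => ih ρ w' ((hΘ.mono hw).cons hS)
  | impE _ _ ih₁ ih₂ => exact ih₁ ρ w hΘ w le_rfl (ih₂ ρ w hΘ)
  | allI _ ih => exact fun a => ih (ρ.cons a) w (hΘ.wk a)
  | allE _ N ih => exact (Judg.sat_inst _ N).2 (ih ρ w hΘ _)
  | exI N _ ih => exact ⟨N.denote ρ, (Judg.sat_inst _ N).1 (ih ρ w hΘ)⟩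
  | exE _ _ ih₁ ih₂ =>
    obtain ⟨a, ha⟩ := ih₁ ρ w hΘ
    exact (Judg.sat_wk a).1 (ih₂ (ρ.cons a) w ((hΘ.wk a).cons ha))
  | eqRefl M => exact rfl
  | eqSubst S _ _ ih₁ ih₂ =>
    refine (Judg.sat_inst S _).2 ?_
    have h := (Judg.sat_inst S _).1 (ih₂ ρ w hΘ)
    have he := ih₁ ρ w hΘ
    exact cast (congrArg (fun a => (Judg.spec S).Sat (ρ.cons a) w) he) h
  | conv h => exact h.denote_eq ρ
  | funExt _ ih =>
    refine funext fun a => ?_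
    have h := ih (ρ.cons a) w (hΘ.wk a)
    simp only [Judg.Sat, Tm.denote, Tm.denote_wk] at h
    exact h
  | specExt _ ih =>
    -- Equality of denotations concerns all worlds at once. The premise supplies this because its
    -- context is empty, so it may be used at any world.
    refine SemSpec.ext (funext fun w => propext ?_)
    exact (Tm.denote_iff_spec _ _ ρ w).1 (ih ρ w (by simp [HypSat])) w le_rfl
  | propExt _ _ ih₁ ih₂ =>
    exact SemProp.ext (funext fun w =>
      (ih₁ ρ w (by simp [HypSat])).antisymm (ih₂ ρ w (by simp [HypSat])))
  | boolCases b =>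
    change b.denote ρ = true ∨ b.denote ρ = false
    exact (b.denote ρ).eq_false_or_eq_true
  | boolNe _ ih => exact absurd (ih ρ w hΘ) Bool.true_eq_false.mp
  | boolAnd b c =>
    refine (Tm.denote_iff_spec _ _ ρ w).2 fun w' _ => ?_
    change Bool.and (b.denote ρ) (c.denote ρ) = true ↔ (b.denote ρ = true ∧ c.denote ρ = true)
    exact Bool.and_eq_true_iff
  | boolOr b c =>
    refine (Tm.denote_iff_spec _ _ ρ w).2 fun w' _ => ?_
    change Bool.or (b.denote ρ) (c.denote ρ) = true ↔ (b.denote ρ = true ∨ c.denote ρ = true)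
    exact Bool.or_eq_true_iff
  | boolImp b c =>
    refine (Tm.denote_iff_spec _ _ ρ w).2 fun w' _ => ?_
    change Bool.or (Bool.not (b.denote ρ)) (c.denote ρ) = true ↔
      ∀ w'', w' ≤ w'' → b.denote ρ = true → c.denote ρ = true
    generalize b.denote ρ = x, c.denote ρ = y
    -- The Kripke implication collapses to the Boolean one because the truth of a Boolean does not
    -- depend on the world.
    refine ⟨fun h _ _ hx => ?_, fun h => ?_⟩
    · subst hx
      exact h
    · cases x
      · rfl
      · exact h w' le_rfl rfl
  | boolAll τ b =>
    classical
    exact (Tm.denote_iff_spec _ _ ρ w).2 fun w' _ => decide_eq_true_iff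
  | boolEx τ b =>
    classical
    exact (Tm.denote_iff_spec _ _ ρ w).2 fun w' _ => decide_eq_true_iff
  | boolEq M N =>
    classical
    exact (Tm.denote_iff_spec _ _ ρ w).2 fun w' _ => decide_eq_true_iff
  | succInj _ ih => exact Nat.succ.inj (ih ρ w hΘ)
  | zeroNe _ ih => exact (Nat.succ_ne_zero _ (ih ρ w hΘ).symm).elim
  | natInd F _ _ ih₁ ih₂ =>
    intro n
    have h₂ := ih₂ ρ w hΘ
    have h : ∀ n : ℕ, SemSpec.holds (F.denote ρ n) w := by
      intro n
      induction n with
      | zero => exact ih₁ ρ w hΘ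
      | succ n ih =>
        have h := h₂ n w le_rfl
        simp only [Tm.denote, Tm.denote_wk] at h
        exact h ih
    change SemSpec.holds (F.wk.denote (Env.cons (σ := .nat) n ρ) n) w
    rw [Tm.denote_wk]
    exact h n
  | consInj₁ _ ih => exact (List.cons.inj (ih ρ w hΘ)).1
  | consInj₂ _ ih => exact (List.cons.inj (ih ρ w hΘ)).2
  | nilNe _ ih => exact (List.cons_ne_nil _ _ (Eq.symm (ih ρ w hΘ))).elim
  | @seqInd _ _ τ F _ _ ih₁ ih₂ =>
    intro l
    have h₂ := ih₂ ρ w hΘ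
    have h : ∀ l : List τ.denote, SemSpec.holds (F.denote ρ l) w := by
      intro l
      induction l with
      | nil => exact ih₁ ρ w hΘ
      | cons a l ih =>
        have h := h₂ l a w le_rfl
        simp only [Tm.denote, Tm.denote_wk] at h
        exact h ih
    change SemSpec.holds (F.wk.denote (Env.cons (σ := .seq τ) l ρ) l) w
    rw [Tm.denote_wk]
    exact h l
  | locNe hl _ ih => exact (hl (ih ρ w hΘ)).elim
  | valNe hu hv hab _ ih =>
    refine (hab ?_).elim
    rw [← Tm.tag_denote hu ρ, ← Tm.tag_denote hv ρ]
    exact congrArg Value.tag (ih ρ w hΘ)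
  | locInj _ ih => exact Value.loc.inj (ih ρ w hΘ)
  | pairInj₁ _ ih =>
    have h := (Value.pair.inj (ih ρ w hΘ)).1
    change Value.wk _ = Value.wk _ at h
    rw [Value.wk_zero, Value.wk_zero] at h
    exact h
  | pairInj₂ _ ih =>
    have h := (Value.pair.inj (ih ρ w hΘ)).2
    change Value.wk _ = Value.wk _ at h
    rw [Value.wk_zero, Value.wk_zero] at h
    exact h
  | entRefl P => exact subset_rfl
  | entTrans _ _ ih₁ ih₂ => exact (ih₁ ρ w hΘ).trans (ih₂ ρ w hΘ)
  | entTopI P => exact Set.subset_univ _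
  | entBotE P => exact Set.empty_subset _
  | entAndI _ _ ih₁ ih₂ => exact Set.subset_inter (ih₁ ρ w hΘ) (ih₂ ρ w hΘ)
  | entAndE₁ P Q => exact Set.inter_subset_left
  | entAndE₂ P Q => exact Set.inter_subset_right
  | entOrI₁ P Q => exact Set.subset_union_left
  | entOrI₂ P Q => exact Set.subset_union_right
  | entOrE _ _ ih₁ ih₂ => exact Set.union_subset (ih₁ ρ w hΘ) (ih₂ ρ w hΘ)
  | @entImpI _ _ P Q R _ ih =>
    exact fun m hm m' hm' w' hw hQ =>
      ih ρ w' (hΘ.mono hw) ⟨SemProp.upper (P.denote ρ) (SemProp.mono (P.denote ρ) hw hm) hm', hQ⟩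
  | entImpE _ ih => exact fun m hm => ih ρ w hΘ hm.1 m (.refl m) w le_rfl hm.2
  | @entAllI _ _ τ P Q _ ih =>
    intro m hm a
    have h := ih (ρ.cons a) w (hΘ.wk a)
    simp only [Judg.Sat, Tm.denote_wk] at h
    exact h hm
  | entAllE P N =>
    intro m hm
    rw [Tm.denote_inst]
    exact hm _
  | entExI P N =>
    intro m hm
    rw [Tm.denote_inst] at hm
    exact ⟨_, hm⟩
  | entExE _ ih =>
    rintro m ⟨a, hm⟩
    have h := ih (ρ.cons a) w (hΘ.wk a)
    simp only [Judg.Sat, Tm.denote_wk] at h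
    exact h hm
  | starMono _ _ ih₁ ih₂ =>
    rintro m ⟨m₁, m₂, h₁, h₂, hj⟩
    exact ⟨m₁, m₂, ih₁ ρ w hΘ h₁, ih₂ ρ w hΘ h₂, hj⟩
  | starComm P Q => exact SemProp.star_comm
  | starAssoc P Q R => exact SemProp.star_assoc
  | starEmpI P => exact fun m hm => ⟨m, Res.one, hm, Set.mem_univ _, .one m⟩
  | starEmpE P => exact SemProp.star_left
  | affine P => exact Set.subset_univ _
  | @wandI _ _ P Q R _ ih =>
    intro m hm w' hw m' hm' m'' mm hj hQ
    exact ih ρ w' (hΘ.mono hw)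
      ⟨m', m'', SemProp.upper (P.denote ρ) (SemProp.mono (P.denote ρ) hw hm) hm', hQ, hj⟩
  | wandE _ ih =>
    rintro m ⟨m₁, m₂, h₁, h₂, hj⟩
    exact ih ρ w hΘ h₁ w le_rfl m₁ (.refl m₁) m₂ m hj h₂
  | ptsExcl l u v => exact fun m hm => SemProp.pointsTo_excl hm
  | ptsAgree l u v => exact fun m hm => Option.some.inj (hm.1.symm.trans hm.2)
  | pSpec h P => exact fun m _ => hΘ _ h
  | pValid h P =>
    have hQ := hΘ _ h
    exact fun m _ => Set.eq_univ_iff_forall.1 hQ m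
  | specE _ ih => exact fun m hm => ih ρ w (hΘ.cons hm.2) hm.1
  | specAll S => exact fun m hm a => hm a
  | eqSpec M N => exact fun m hm => hm
  | specEq M N => exact fun m hm => hm
  | valid _ ih => exact Set.eq_univ_iff_forall.2 fun m => ih ρ w hΘ (Set.mem_univ m)
  | pInvDupl I => exact fun m hm => ⟨m, Res.one, hm, hm, .one m⟩
  | pHistDupl t => exact SemProp.hist_dupl
  | pUseHist t₁ t₂ =>
    intro m hm
    exact ⟨m, Res.one, SemProp.star_left hm,
      Tm.denote_isPrefix (SemProp.prefix_of_trace_hist hm) w _, .one m⟩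
  | pAllocHist t => exact SemProp.trace_hist
  | traceExcl t t' => exact fun m hm => SemProp.trace_excl hm
  | ret v =>
    intro w' _ m _
    refine (Tm.denote_valE v ρ).symm ▸ wp_value ?_
    exact (Tm.denote_wk v _ ρ).symm
  | specOut _ ih =>
    rintro w' hw m ⟨m₁, m₂, h₁, h₂, hj⟩
    exact wp_upper (ih ρ w' ((hΘ.mono hw).cons h₂) w' le_rfl h₁) ⟨m₂, hj⟩
  | frame R _ ih =>
    rintro w' hw m ⟨m₁, m₂, h₁, h₂, hj⟩
    refine wp_frame ?_ (ih ρ w hΘ w' hw h₁) h₂ hj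
    intro w'' _ v m₁ m₂ m h₁ h₂ hj
    simp only [Tm.denote, Tm.denote_wk]
    exact ⟨m₁, m₂, h₁, h₂, hj⟩
  | bind K _ _ ih₁ ih₂ =>
    intro w' hw m hm
    change m ∈ wp _ ((K.fill _).denote ρ) w'
    rw [KCtx.denote_fill]
    refine wp_bind (K.denote ρ) ?_ (ih₁ ρ w hΘ w' hw hm)
    intro w'' hw' v m hm
    have h := ih₂ (Env.cons (σ := .val) v ρ) w (hΘ.wk (σ := .val) v) w'' (hw.trans hw') hm
    change m ∈ wp _ ((K.wk.fill _).denote (Env.cons (σ := .val) v ρ)) w'' at h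
    rw [KCtx.denote_fill, KCtx.denote_wk] at h
    change m ∈ wp _ ((K.denote ρ).fill ((Tm.valE (.var .zero)).denote (Env.cons (σ := .val) v ρ))) w'' at h
    rw [Tm.denote_valE] at h
    refine wp_mono ?_ h
    intro w₃ _ u m hm
    -- The intermediate value returned by `e` witnesses the existential in the postcondition.
    refine ⟨v, ?_⟩
    simp only [Tm.denote, Tm.denote_wk']
    exact hm
  | csq _ _ _ ih₁ ih₂ ih₃ =>
    intro w' hw m hm
    refine wp_mono ?_ (ih₂ ρ w hΘ w' hw (ih₁ ρ w' (hΘ.mono hw) hm))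
    intro w'' hw' v
    have h := ih₃ (Env.cons (σ := .val) v ρ) w'' ((hΘ.mono (hw.trans hw')).wk (σ := .val) v)
    simp only [Judg.Sat, Tm.denote, Tm.denote_wk] at h
    exact h
  | tripleEx _ ih =>
    rintro w' hw m ⟨a, hm⟩
    have h := ih (ρ.cons a) w (hΘ.wk a) w' hw hm
    rwa [Tm.denote_wk, Tm.denote_wk] at h
  | tripleOr _ _ ih₁ ih₂ =>
    rintro w' hw m (hm | hm)
    · exact ih₁ ρ w hΘ w' hw hm
    · exact ih₂ ρ w hΘ w' hw hm
  | @abs _ _ P Q e _ ih =>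
    intro w' hw m _
    -- The function may be called in any world `w₃` after its creation. Its binding persists there,
    -- and the premise, true at `w`, covers all later worlds.
    refine wp_lam fun f w'' hw' hf v w₃ hw₃ m hm => ?_
    rw [Tm.denote_wk'] at hm
    have h := ih (ρ.cons v) w (hΘ.wk v) w₃ ((hw.trans hw').trans hw₃) hm
    change m ∈ wp _ (.app ((Tm.valE (.var (.succ .zero))).denote _)
      ((Tm.valE (.var .zero)).denote _)) w₃
    rw [Tm.denote_wk', Tm.denote_valE, Tm.denote_valE]
    refine wp_call (hw₃.1 _ _ hf) ?_
    rw [← Tm.denote_psubst_one]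
    exact h
  | fst u v =>
    intro w' _ m _
    change m ∈ wp _ (.fst (.pair ((Tm.valE u).denote ρ) ((Tm.valE v).denote ρ))) w'
    rw [Tm.denote_valE, Tm.denote_valE]
    exact wp_fst (Tm.denote_wk u _ ρ).symm
  | snd u v =>
    intro w' _ m _
    change m ∈ wp _ (.snd (.pair ((Tm.valE u).denote ρ) ((Tm.valE v).denote ρ))) w'
    rw [Tm.denote_valE, Tm.denote_valE]
    exact wp_snd (Tm.denote_wk v _ ρ).symm
  | itePos hz _ ih =>
    intro w' hw m hm
    change m ∈ wp _ (.ite ((Tm.valE _).denote ρ) ((Tm.eterm _).denote ρ)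
      ((Tm.eterm _).denote ρ)) w'
    rw [Tm.denote_valE, Tm.denote_eterm, Tm.denote_eterm]
    exact wp_itePos hz (ih ρ w hΘ w' hw hm)
  | iteZero _ ih =>
    intro w' hw m hm
    change m ∈ wp _ (.ite ((Tm.valE _).denote ρ) ((Tm.eterm _).denote ρ)
      ((Tm.eterm _).denote ρ)) w'
    rw [Tm.denote_valE, Tm.denote_eterm, Tm.denote_eterm]
    exact wp_iteZero (ih ρ w hΘ w' hw hm)
  | arith o a b =>
    intro w' _ m _
    change m ∈ wp _ (.binop _ ((Tm.valE _).denote ρ) ((Tm.valE _).denote ρ)) w'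
    rw [Tm.denote_valE, Tm.denote_valE]
    exact wp_arith rfl
  | @eqTrue _ _ u v _ ih =>
    intro w' _ m _
    change m ∈ wp _ (.binop _ ((Tm.valE _).denote ρ) ((Tm.valE _).denote ρ)) w'
    rw [Tm.denote_valE, Tm.denote_valE]
    have h : u.denote ρ = v.denote ρ := ih ρ w hΘ
    rw [h]
    exact wp_eqTrue rfl
  | eqFalse _ ih =>
    intro w' _ m _
    change m ∈ wp _ (.binop _ ((Tm.valE _).denote ρ) ((Tm.valE _).denote ρ)) w'
    rw [Tm.denote_valE, Tm.denote_valE]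
    exact wp_eqFalse (ih ρ w hΘ w le_rfl) rfl
  | alloc v =>
    intro w' _ m _
    change m ∈ wp _ (.ref ((Tm.valE v).denote ρ)) w'
    rw [Tm.denote_valE]
    refine wp_alloc fun l hl => ⟨l, SemProp.mem_star_of_right ?_ rfl⟩
    rw [Tm.denote, Tm.denote_wk, Tm.denote_wk]
    exact Finmap.lookup_insert _
  | read l v =>
    intro w' _ m hm
    change m ∈ wp _ (.deref ((Tm.valE (.locV l)).denote ρ)) w'
    rw [Tm.denote_valE]
    refine wp_read hm ?_
    simp only [Tm.denote, Tm.denote_wk]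
    exact SemProp.mem_star_of_left hm rfl
  | write l v =>
    rintro w' _ m ⟨u, hm⟩
    simp only [Tm.denote, Tm.denote_wk] at hm
    change m ∈ wp _ (.binop _ ((Tm.valE _).denote ρ) ((Tm.valE _).denote ρ)) w'
    rw [Tm.denote_valE, Tm.denote_valE]
    refine wp_write hm ?_
    simp only [Tm.denote, Tm.denote_wk]
    exact SemProp.mem_star_of_left (Finmap.lookup_insert _) rfl
  | emit I t v _ ih =>
    intro w' hw m hm
    have hI : I.denote ρ ((t.snoc v).denote ρ) = true := ih ρ w hΘ
    -- The precondition identifies the invariant of the world with `I`, so the premise `hI` becomes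
    -- the invariant condition of `wp_emit`.
    have hinv : w'.inv = {t | I.denote ρ t = true} := SemProp.star_right hm
    have ht := SemProp.mem_trace.1 (SemProp.star_left hm)
    change m ∈ wp _ (.emit (Value.wk (v.denote ρ))) w'
    rw [Value.wk_zero]
    rw [Tm.denote_snoc] at hI
    refine wp_emit ht (hinv ▸ hI) (SemProp.mem_star_of_left (SemProp.mem_trace.2 ?_) rfl)
    rw [Tm.denote_wk, Tm.denote_snoc]
    rfl

/-- Sequential composition. -/
theorem wp_seq {Q R : Val → SemProp} {e₁ e₂ : Exp} {w : World} {m : Res}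
    (h₂ : ∀ w', w ≤ w' → ∀ v, (Q v).sat w' ⊆ wp R e₂ w')
    (h₁ : ∀ w', w ≤ w' → m ∈ wp Q e₁ w') :
    m ∈ wp R (.app (.lam (e₂.subst PSub.empty)) e₁) w := by
  -- The postcondition of the abstraction `λ _. e₂`: it remembers the name's binding and that `e₁`
  -- is still safe to run. Safety is stated at all later worlds so that `Q₀` is monotone; `wp`
  -- itself speaks only of states with exactly the environment of its world.
  let Q₀ : Val → SemProp := fun u => ⟨fun w' => {m | m ∈ SemProp.sat (Kind.top .prop) w' ∧
      ∃ f, u = .fn f ∧ w'.env.lookup f = some (e₂.subst PSub.empty) ∧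
        ∀ w'', w' ≤ w'' → m ∈ wp Q e₁ w''},
    fun h m ⟨hm, f, hu, hf, hm'⟩ => ⟨hm, f, hu, h.1 _ _ hf, fun w'' h' => hm' w'' (h.trans h')⟩,
    fun ⟨hm, f, hu, hf, hm'⟩ h => ⟨hm, f, hu, hf, fun w'' h' => wp_upper (hm' w'' h') h⟩⟩
  refine wp_bind (Q := Q₀) (.appL .hole e₁) ?_ (wp_lam fun f w' hw hf =>
    ⟨Set.mem_univ _, f, rfl, hf, fun w'' h => h₁ w'' (hw.trans h)⟩)
  rintro w' hw _ m ⟨-, f, rfl, hf, hm⟩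
  refine wp_bind (.appR (.fn f) .hole) (fun w'' hw' v m hv => ?_) (hm w' le_rfl)
  refine wp_call (hw'.1 _ _ hf) ?_
  -- The body ignores its argument, so the call reduces to `e₂`.
  rw [Expr.inst, Expr.subst_subst, Expr.subst_closed]
  exact h₂ w'' (hw.trans hw') v hv

end TraceSL

/-! ### Putting client, library and initialiser together. -/

theorem theorem2
    (Φ : Term [] (.arrow (.prod .prop .exp) .spec)) (P₀ : Term [] .prop)
    (Iinit Iops : Term [] .exp) (e : Term [.exp] .exp)
    (L : Term [] (.arrow (.seq .val) .bool))
    (s s' : State) (t : Trace) (e' : Exp)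
    (hε : [] ∈ L.language)
    (hclient : Deriv [] (.spec
      (.all .exp (.all .prop
        (.imp (.app Φ.wk.wk (.pair (.var .zero) (.var (.succ .zero))))
          (.hoare (.var .zero) e.wk (.post (.top .prop))))))))
    (hinit : Deriv [] (.spec (.hoare (.top .prop) Iinit (.post P₀))))
    (hlib : Deriv [] (.spec
      (.app Φ (.pair (.star (.star P₀ (.trace .nil)) (.inv L)) Iops))))
    (hrun : Steps (Tm.seqE Iinit (e.inst Iops)).toProgram s t e' s')
    (hfinal : Stuck e' s') :
    t ∈ L.language := by
  -- The environment is forced by realization of `s`; the invariant is the language to be enforced.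
  let w : World := ⟨s.env, L.language⟩
  have hnil : HypSat [] Env.nil w := by simp [HypSat]
  let P : SemProp := Tm.denote (.star (.star P₀ (.trace .nil)) (.inv L)) Env.nil
  -- The client's abstract `P` is instantiated with the library's concrete precondition, which
  -- includes the trace ownership and the invariant.
  have hc := hclient.sound Env.nil w hnil (Iops.denote Env.nil) P w le_rfl
  change SemSpec.holds (Φ.wk.wk.denote (Env.cons (σ := .prop) P
    (Env.cons (σ := .exp) (Iops.denote Env.nil) Env.nil)) (P, Iops.denote Env.nil)) w →
    ∀ w', w ≤ w' → P.sat w' ⊆ wp _ (e.wk.denote _) w' at hc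
  rw [Tm.denote_wk, Tm.denote_wk, Tm.denote_wk, ← Tm.denote_inst] at hc
  have hbody := hc (hlib.sound Env.nil w hnil)
  have hi : ∀ w', w ≤ w' → ∀ m, m ∈ wp (fun _ => P₀.denote Env.nil) (Iinit.denote Env.nil) w' := by
    intro w' hw m
    refine wp_mono (fun w'' _ v => ?_) (hinit.sound Env.nil w hnil w' hw (Set.mem_univ m))
    change SemProp.sat (P₀.wk.denote (Env.cons (σ := .val) v Env.nil)) w'' ⊆ _
    rw [Tm.denote_wk]
  have hprog : (Tm.seqE Iinit (e.inst Iops)).toProgram =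
      .app (.lam (((e.inst Iops).denote Env.nil).subst PSub.empty)) (Iinit.denote Env.nil) :=
    congrArg (Expr.app _) (Expr.subst_closed _ _)
  rw [hprog] at hrun
  -- The initial resource is the whole heap with ownership of the empty trace; realizing it needs
  -- `[] ∈ L.language`.
  refine wp_adequate (t := []) (w := w) (m := (s.heap, .trace [])) hrun
    (wp_seq (Q := fun _ => P) (fun w' hw v => hbody w' hw) fun w' hw => ?_)
    ⟨rfl, rfl, rfl, hε⟩
  -- The initialiser runs on the unit resource, and all of `(s.heap, .trace [])` is framed. The
  -- assertion `inv(L)` holds in `w'` because later worlds keep the invariant.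
  refine wp_frame (R := SemProp.star (SemProp.tracing (.trace []))
      (Tm.denote (.inv L) Env.nil)) (fun w'' _ v m₁ m₂ m h₁ h₂ hj => ?_)
    (hi w' hw Res.one) (SemProp.mem_star_of_left (SemProp.mem_trace.2 rfl) hw.2.symm)
    (Join.one _).comm
  obtain ⟨m₃, m₄, h₃, h₄, hj'⟩ := h₂
  -- Regroups `P₀ * (trace(ε) * inv(L))` as `(P₀ * trace(ε)) * inv(L)`, the form of `P`.
  obtain ⟨x, hx, h⟩ := hj'.assoc' hj
  exact ⟨x, m₄, ⟨m₁, m₃, h₁, h₃, hx⟩, h₄, h⟩
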